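/- Let $d\ge 0$, let $\mathbf p(t)=(1,t,\dots,t^d)^{\mathrm T}$ and $\mathbf q(t)=(1,t,\dots,t^{2d})^{\mathrm T}$ be the monomial bases of the real univariate polynomials of degree at most $d$ and $2d$, and let $\Lambda:\mathbb R^{2d+1}\to\mathbb R^{(d+1)\times(d+1)}$ be the unique linear map with $\Lambda(\mathbf q(t))=\mathbf p(t)\mathbf p(t)^{\mathrm T}$ for all $t\in\mathbb{R}$. Then $\Lambda(\mathbf x)$ is the Hankel matrix $(x_{i+j})_{i,j=0,\dots,d}$ of $\mathbf x=(x_0,\dots,x_{2d})$. Let $\Sigma_{1,2d}\subset\mathbb R^{2d+1}$ be the cone of coefficient vectors (in the basis $\mathbf q$) of finite sums of squares of real univariate polynomials of degree at most $d$, let $\Sigma_{1,2d}^*=\{\mathbf x : \mathbf s^{\mathrm T}\mathbf x\ge 0\ \ \forall\,\mathbf s\in\Sigma_{1,2d}\}$ be its dual cone, and let $F(\mathbf x)=-\ln\det\Lambda(\mathbf x)$ on the interior of $\Sigma_{1,2d}^*$. There $\det\Lambda(\mathbf x)>0$ and $F$ is twice continuously differentiable. The gradient $\nabla F(\mathbf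 x)$ and the Hessian $\nabla^2F(\mathbf x)$ can be computed in $O(d^2\log d)$ time in exact real arithmetic. More precisely, there are a single program of a real random access machine and a function $T:\mathbb N\to\mathbb N$ with $T(d)=O(d^2\log d)$ as $d\to\infty$ such that, for every $d$ and every $\mathbf x$ in the interior of $\Sigma_{1,2d}^*$, the program on input $(d,\mathbf x)$ halts after at most $T(d)$ steps and outputs all entries of $\nabla F(\mathbf x)$ and of $\nabla^2F(\mathbf x)$. Here one step is one of the following: an addition, subtraction, multiplication or division (by a nonzero number) of two reals; the loading of a rational constant; an addition or truncated subtraction of two indices (natural numbers); the loading of an index constant; a comparison of two reals or of two indices; an indirectly addressed read or write of one array cell; a no-op. -/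

import Mathlib

open Polynomial

/-! ## The barrier of the dual sum-of-squares cone -/

namespace SOSBarrier

/-- The defining relation `Λ(q) = p pᵀ` of the linear operator `Λ` attached to (ordered) bases
`p` and `q`, as an identity between matrices of polynomial functions of `t`. -/
def IsSOSOperator {ι κ : Type*} (p : ι → ℝ[X]) (q : κ → ℝ[X])
    (Λ : (κ → ℝ) →ₗ[ℝ] Matrix ι ι ℝ) : Prop :=
  ∀ t : ℝ, Λ (fun u => (q u).eval t) =
    Matrix.vecMulVec (fun i => (p i).eval t) (fun i => (p i).eval t)

/-- The ordered monomial basis `1, t, …, t ^ r` of the univariate polynomials of degree `≤ r`. -/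
noncomputable def monomials (r : ℕ) : Fin (r + 1) → ℝ[X] :=
  fun i => X ^ (i : ℕ)

/-- The Hankel matrix `(x_{i+j})`, `0 ≤ i, j ≤ d`, of `x = (x_0, …, x_{2d})`. -/
def hankel (d : ℕ) (x : Fin (2 * d + 1) → ℝ) : Matrix (Fin (d + 1)) (Fin (d + 1)) ℝ :=
  Matrix.of fun i j => x ⟨(i : ℕ) + (j : ℕ), by omega⟩

/-- The vectors `s` for which `∑ s_u q_u` is a finite sum of squares of univariate polynomials
of degree at most `d`. -/
def sosCone (d : ℕ) {κ : Type*} [Fintype κ] (q : κ → ℝ[X]) : Set (κ → ℝ) :=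
  {s | ∃ (M : ℕ) (r : Fin M → ℝ[X]), (∀ j, r j ∈ degreeLE ℝ (d : WithBot ℕ)) ∧
    ∑ u, s u • q u = ∑ j, r j ^ 2}

/-- The dual cone with respect to the standard inner product. -/
def dualCone {κ : Type*} [Fintype κ] (K : Set (κ → ℝ)) : Set (κ → ℝ) :=
  {x | ∀ s ∈ K, 0 ≤ s ⬝ᵥ x}

/-- The interior of the dual of the cone of univariate sum-of-squares polynomials of degree `2d`,
in the monomial basis: the domain of the barrier. -/
def barrierDomain (d : ℕ) : Set (Fin (2 * d + 1) → ℝ) :=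
  interior (dualCone (sosCone d (monomials (2 * d))))

/-- The barrier `x ↦ -ln det Λ(x)`. -/
noncomputable def barrier {ι κ : Type*} [Fintype ι] [DecidableEq ι]
    (Λ : (κ → ℝ) →ₗ[ℝ] Matrix ι ι ℝ) (x : κ → ℝ) : ℝ :=
  -Real.log (Λ x).det

/-- The partial derivative `∂F/∂x_u`. -/
noncomputable def partialDeriv {κ : Type*} [DecidableEq κ] (u : κ) (F : (κ → ℝ) → ℝ)
    (x : κ → ℝ) : ℝ :=
  lineDeriv ℝ F x (Pi.single u 1)

/-- The gradient, as the vector of the first partial derivatives. -/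
noncomputable def grad {κ : Type*} [DecidableEq κ] (F : (κ → ℝ) → ℝ) (x : κ → ℝ) : κ → ℝ :=
  fun u => partialDeriv u F x

/-- The Hessian, as the matrix of the second partial derivatives `∂²F/∂x_u∂x_v`. -/
noncomputable def hess {κ : Type*} [DecidableEq κ] (F : (κ → ℝ) → ℝ) (x : κ → ℝ) :
    Matrix κ κ ℝ :=
  Matrix.of fun u v => partialDeriv u (partialDeriv v F) x

end SOSBarrier

/-! ## A real random access machine with a step count

Exact real arithmetic at unit cost. A machine has index registers holding natural numbers, real
registers, and one-dimensional arrays of real cells which are addressed indirectly, through the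
index registers. A program is a finite text that names finitely many registers and arrays and does
not depend on the input size. There is no conversion from reals to indices, index arithmetic is
limited to addition and truncated subtraction, and division by zero makes the machine fail. -/

namespace RealRAM

/-- A machine state: index registers, real registers, and real arrays
(`arr a k` is cell `k` of array `a`). -/
structure State where
  idx : ℕ → ℕ
  reg : ℕ → ℝ
  arr : ℕ → ℕ → ℝ

/-- The instructions; all operands are names of registers or arrays, except for the constants. -/
inductive Instr where
  | iconst (i n : ℕ)
  | iadd (i j k : ℕ)
  | isub (i j k : ℕ)
  | rconst (i : ℕ) (c : ℚ)
  | radd (i j k : ℕ)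
  | rsub (i j k : ℕ)
  | rmul (i j k : ℕ)
  | rdiv (i j k : ℕ)
  | load (i a k : ℕ)
  | store (a k i : ℕ)

/-- The effect of an instruction: the first operand is the target, `load i a k` copies the cell of
array `a` whose address is in index register `k` to real register `i`, `store a k i` copies back.
The value `none` is failure. -/
noncomputable def Instr.exec : Instr → State → Option State
  | .iconst i n, s => some { s with idx := Function.update s.idx i n }
  | .iadd i j k, s => some { s with idx := Function.update s.idx i (s.idx j + s.idx k) }
  | .isub i j k, s => some { s with idx := Function.update s.idx i (s.idx j - s.idx k) }
  | .rconst i c, s => some { s with reg := Function.update s.reg i (c : ℝ) }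
  | .radd i j k, s => some { s with reg := Function.update s.reg i (s.reg j + s.reg k) }
  | .rsub i j k, s => some { s with reg := Function.update s.reg i (s.reg j - s.reg k) }
  | .rmul i j k, s => some { s with reg := Function.update s.reg i (s.reg j * s.reg k) }
  | .rdiv i j k, s =>
      open scoped Classical in
      if s.reg k = 0 then none
      else some { s with reg := Function.update s.reg i (s.reg j / s.reg k) }
  | .load i a k, s => some { s with reg := Function.update s.reg i (s.arr a (s.idx k)) }
  | .store a k i, s =>
      some { s with arr := Function.update s.arr a
                              (Function.update (s.arr a) (s.idx k) (s.reg i)) }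

/-- The tests: comparison of two index registers, or of two real registers. -/
inductive Test where
  | ilt (i j : ℕ)
  | rlt (i j : ℕ)

/-- When a test succeeds. -/
def Test.Holds : Test → State → Prop
  | .ilt i j, s => s.idx i < s.idx j
  | .rlt i j, s => s.reg i < s.reg j

/-- Programs: instructions, sequencing, branching, and while-loops. -/
inductive Program where
  | skip
  | instr (i : Instr)
  | seq (P Q : Program)
  | branch (b : Test) (P Q : Program)
  | loop (b : Test) (P : Program)

/-- `Runs P s n s'`: started in state `s`, the program `P` halts without failure in state `s'` after
exactly `n` steps. Every instruction and every evaluation of a test is one step. -/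
inductive Runs : Program → State → ℕ → State → Prop where
  | skip (s : State) : Runs .skip s 1 s
  | instr {i : Instr} {s s' : State} (h : i.exec s = some s') : Runs (.instr i) s 1 s'
  | seq {P Q : Program} {s s' s'' : State} {m n : ℕ}
      (hP : Runs P s m s') (hQ : Runs Q s' n s'') : Runs (.seq P Q) s (m + n) s''
  | branch_true {b : Test} {P Q : Program} {s s' : State} {n : ℕ}
      (hb : b.Holds s) (hP : Runs P s n s') : Runs (.branch b P Q) s (n + 1) s'
  | branch_false {b : Test} {P Q : Program} {s s' : State} {n : ℕ}
      (hb : ¬ b.Holds s) (hQ : Runs Q s n s') : Runs (.branch b P Q) s (n + 1) s'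
  | loop_true {b : Test} {P : Program} {s s' s'' : State} {m n : ℕ}
      (hb : b.Holds s) (hP : Runs P s m s') (hL : Runs (.loop b P) s' n s'') :
      Runs (.loop b P) s (m + n + 1) s''
  | loop_false {b : Test} {P : Program} {s : State} (hb : ¬ b.Holds s) :
      Runs (.loop b P) s 1 s

/-- The initial state on input `(d, x)`: index register `0` holds `d`, array `0` holds
`x_0, …, x_{2d}`, and everything else is zero. -/
def initial (d : ℕ) (x : Fin (2 * d + 1) → ℝ) : State where
  idx := Function.update (fun _ => 0) 0 d
  reg := fun _ => 0
  arr := Function.update (fun _ _ => 0) 0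
    (fun k => if h : k < 2 * d + 1 then x ⟨k, h⟩ else 0)

end RealRAM

/-! Let `H` be the Hankel matrix of `x` and `L` the functional with moments `x`. At an interior
point of the dual cone `L` is positive on nonzero squares of degree at most `2d`, so `H` is positive
definite and monic orthogonal polynomials `p_0, …, p_{d+1}` exist. The kernel `K(x, y) = ∑_{k ≤ d}
p_k(x) p_k(y) / h_k`, with `h_k = L(p_k²)`, has `H⁻¹` as its coefficient matrix
(`hankel_mul_kernel`).

By Jacobi's formula `∂²F/∂x_u∂x_v = tr(H⁻¹ E_u H⁻¹ E_v)`, where `E_u` is the 0/1 matrix supported on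
the antidiagonal `i + j = u`. Written out, this is the coefficient of `x^u y^v` in `K²`
(`hess_barrier_eq_coeff`). The gradient then costs one matrix-vector product, since Euler's relation
gives `∇F = -(∇²F) x` (`grad_barrier_eq_sum`).

Put `a = p_{d+1}`, `b = p_d`, `h = h_d`. The Christoffel–Darboux formula `(x - y) K = (a(x) b(y) -
b(x) a(y)) / h` (`sub_mul_kernel`), squared, expresses `(x - y)² K²` through the coefficients of
`a²`, `b²` and `ab`. Dividing by `(x - y)²` coefficientwise gives each Hessian entry in boundedly
many operations from two earlier rows (`RealRAM.isQuotient_kernel`).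

The recurrence for `a, b, h`, the schoolbook products and the division each take `O(d²)` steps, so
no fast Fourier transform is needed and the bound obtained is better than `O(d² log d)`.

Computing `a` involves the moment of index `2d + 1`, which is not part of the input and is padded by
zero. Its value affects `a` only by a multiple of `b`, which cancels in the Christoffel–Darboux
formula. -/

namespace OrthogonalPolynomial

/-! ### Moment functionals and the three-term recurrence -/

/-- The linear functional on polynomials with moments `m 0, m 1, …`. -/
noncomputable def momentFunctional (m : ℕ → ℝ) : ℝ[X] →ₗ[ℝ] ℝ :=
  Polynomial.lsum fun i => m i • LinearMap.id

theorem momentFunctional_monomial (m : ℕ → ℝ) (i : ℕ) (c : ℝ) :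
    momentFunctional m (monomial i c) = c * m i := by
  simp [momentFunctional, Polynomial.lsum, Polynomial.sum_monomial_index, mul_comm]

theorem momentFunctional_X_pow_mul (m : ℕ → ℝ) (k N : ℕ) (p : ℝ[X]) (hp : p.natDegree < N) :
    momentFunctional m (X ^ k * p) = ∑ i ∈ Finset.range N, p.coeff i * m (i + k) := by
  conv_lhs => rw [p.as_sum_range' N hp]
  rw [Finset.mul_sum, map_sum]
  refine Finset.sum_congr rfl fun i _ => ?_
  rw [X_pow_mul_monomial, momentFunctional_monomial]

theorem momentFunctional_mul (m : ℕ → ℝ) (d : ℕ) (p q : ℝ[X]) (hp : p.natDegree < d)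
    (hq : q.natDegree < d) :
    momentFunctional m (p * q) =
      ∑ i : Fin d, ∑ j : Fin d, p.coeff i * m (i + j) * q.coeff j := by
  conv_lhs => rw [p.as_sum_range' d hp]
  rw [Finset.sum_mul, map_sum, Finset.sum_range]
  refine Finset.sum_congr rfl fun i _ => ?_
  rw [← C_mul_X_pow_eq_monomial, mul_assoc, ← smul_eq_C_mul, map_smul,
    momentFunctional_X_pow_mul m _ d q hq, Finset.sum_range, smul_eq_mul, Finset.mul_sum]
  refine Finset.sum_congr rfl fun j _ => ?_
  rw [add_comm (j : ℕ)]
  ring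

theorem degree_C_mul_le' (c : ℝ) (p : ℝ[X]) : (C c * p).degree ≤ p.degree := by
  rw [← smul_eq_C_mul]
  exact degree_smul_le c p

theorem momentFunctional_C_mul (m : ℕ → ℝ) (c : ℝ) (p : ℝ[X]) :
    momentFunctional m (C c * p) = c * momentFunctional m p := by
  rw [← smul_eq_C_mul, map_smul, smul_eq_mul]

/-- The data carried along by the three-term recurrence: the monic orthogonal polynomials of
degrees `k` and `k - 1`, the squared norm `h` of the latter, and the quotient
`L(t ^ k p_{k-1}) / h`. -/
structure Recurrence where
  cur : ℝ[X]
  prev : ℝ[X]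
  norm : ℝ
  shift : ℝ

/-- The three-term recurrence of the monic orthogonal polynomials of a moment sequence. -/
noncomputable def recurrence (m : ℕ → ℝ) : ℕ → Recurrence
  | 0 => ⟨1, 0, 1, 0⟩
  | k + 1 =>
    let S := recurrence m k
    let h := momentFunctional m (X ^ k * S.cur)
    let σ := momentFunctional m (X ^ (k + 1) * S.cur) / h
    ⟨X * S.cur - C (σ - S.shift) * S.cur - C (h / S.norm) * S.prev, S.cur, h, σ⟩

/-- The functional is positive on nonzero squares of polynomials of degree at most `d`. -/
def IsPositive (m : ℕ → ℝ) (d : ℕ) : Prop :=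
  ∀ p : ℝ[X], p ≠ 0 → p.natDegree ≤ d → 0 < momentFunctional m (p * p)

/-- The properties that characterise the `k`-th state of the recurrence. -/
structure Recurrence.Orthogonal (m : ℕ → ℝ) (k : ℕ) (S : Recurrence) : Prop where
  monic : S.cur.Monic
  natDegree : S.cur.natDegree = k
  degree_prev : S.prev.degree < k
  cur_orth : ∀ j < k, momentFunctional m (X ^ j * S.cur) = 0
  prev_orth : ∀ j, j + 1 < k → momentFunctional m (X ^ j * S.prev) = 0
  norm_pos : 0 < S.norm
  prev_norm : ∀ j, j + 1 = k → momentFunctional m (X ^ j * S.prev) = S.norm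
  prev_shift : momentFunctional m (X ^ k * S.prev) = S.shift * S.norm

theorem Recurrence.Orthogonal.mul_eq_zero {m : ℕ → ℝ} {k : ℕ} {S : Recurrence}
    (hS : S.Orthogonal m k) (q : ℝ[X]) (hq : q.degree < k) :
    momentFunctional m (q * S.cur) = 0 := by
  rw [q.as_sum_range_C_mul_X_pow, Finset.sum_mul, map_sum]
  refine Finset.sum_eq_zero fun i hi => ?_
  rw [mul_assoc, momentFunctional_C_mul]
  by_cases hik : i < k
  · rw [hS.cur_orth i hik, mul_zero]
  · rw [coeff_eq_zero_of_degree_lt (hq.trans_le (by exact_mod_cast not_lt.mp hik)), zero_mul]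

/-- Since `p_k` is monic, `p_k - t^k` has degree below `k` and is orthogonal to `p_k`. Hence the
squared norm is a single moment sum. -/
theorem Recurrence.Orthogonal.mul_self {m : ℕ → ℝ} {k : ℕ} {S : Recurrence}
    (hS : S.Orthogonal m k) :
    momentFunctional m (S.cur * S.cur) = momentFunctional m (X ^ k * S.cur) := by
  have h : (S.cur - (X : ℝ[X]) ^ k).degree < (k : WithBot ℕ) := by
    have := degree_sub_lt_left (p := S.cur) (q := X ^ k)
      (by rw [degree_X_pow, degree_eq_natDegree hS.monic.ne_zero, hS.natDegree])
      hS.monic.ne_zero (by rw [hS.monic, (monic_X_pow k)])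
    rwa [degree_eq_natDegree hS.monic.ne_zero, hS.natDegree] at this
  have := hS.mul_eq_zero _ h
  rw [sub_mul, map_sub] at this
  linarith

/-- Pairing the recurrence with `t^j` gives zero termwise for `j < k - 1`. The coefficient `h_k /
h_{k-1}` is what cancels the case `j = k - 1`, and `σ_k - σ_{k-1}` the case `j = k`. The range
reaches `d + 1` because constructing `p_{d+1}` divides only by `h_0, …, h_d`. -/
theorem recurrence_orthogonal {m : ℕ → ℝ} {d : ℕ} (hm : IsPositive m d) (k : ℕ)
    (hk : k ≤ d + 1) : (recurrence m k).Orthogonal m k := by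
  induction k with
  | zero =>
    constructor <;> simp [recurrence, monic_one]
  | succ k ih =>
    have hS := ih (by omega)
    set S := recurrence m k with hSdef
    have hh : 0 < momentFunctional m (X ^ k * S.cur) := by
      rw [← hS.mul_self]
      exact hm _ hS.monic.ne_zero (by rw [hS.natDegree]; omega)
    set h := momentFunctional m (X ^ k * S.cur) with hhdef
    set σ := momentFunctional m (X ^ (k + 1) * S.cur) / h with hσ
    have hrec : recurrence m (k + 1) =
        ⟨X * S.cur - C (σ - S.shift) * S.cur - C (h / S.norm) * S.prev, S.cur, h, σ⟩ := rfl
    have hcur : S.cur.degree = k := by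
      rw [degree_eq_natDegree hS.monic.ne_zero, hS.natDegree]
    have hlow : (C (σ - S.shift) * S.cur + C (h / S.norm) * S.prev).degree < (X * S.cur).degree := by
      have h1 : (X * S.cur).degree = ((k + 1 : ℕ) : WithBot ℕ) := by
        rw [degree_mul, degree_X, hcur]; push_cast; ring
      rw [h1]
      have hk1 : ((k : ℕ) : WithBot ℕ) < ((k + 1 : ℕ) : WithBot ℕ) := by
        exact_mod_cast Nat.lt_succ_self k
      refine (degree_add_le _ _).trans_lt (max_lt ?_ ?_)
      · exact (degree_C_mul_le' _ _).trans_lt (hcur ▸ hk1)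
      · exact (degree_C_mul_le' _ _).trans_lt (hS.degree_prev.trans hk1)
    have hXm : (X * S.cur).Monic := monic_X.mul hS.monic
    rw [hrec]
    have hmon : (X * S.cur - (C (σ - S.shift) * S.cur + C (h / S.norm) * S.prev)).Monic :=
      hXm.sub_of_left hlow
    have hLcur : ∀ j, momentFunctional m (X ^ j * (X * S.cur - C (σ - S.shift) * S.cur -
        C (h / S.norm) * S.prev)) = momentFunctional m (X ^ (j + 1) * S.cur) -
        (σ - S.shift) * momentFunctional m (X ^ j * S.cur) -
        h / S.norm * momentFunctional m (X ^ j * S.prev) := by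
      intro j
      rw [← momentFunctional_C_mul, ← momentFunctional_C_mul, ← map_sub, ← map_sub]
      congr 1
      ring
    refine ⟨?_, ?_, ?_, ?_, ?_, hh, ?_, ?_⟩
    · simpa only [sub_sub] using hmon
    · show (X * S.cur - C (σ - S.shift) * S.cur - C (h / S.norm) * S.prev).natDegree = k + 1
      rw [sub_sub, natDegree_sub_eq_left_of_natDegree_lt, natDegree_X_mul hS.monic.ne_zero,
        hS.natDegree]
      by_cases h0 : C (σ - S.shift) * S.cur + C (h / S.norm) * S.prev = 0
      · rw [h0, natDegree_zero, natDegree_X_mul hS.monic.ne_zero]; omega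
      · exact natDegree_lt_natDegree h0 hlow
    · show S.cur.degree < _
      rw [hcur]; exact_mod_cast Nat.lt_succ_self k
    · intro j hj
      have hn := hS.norm_pos.ne'
      show momentFunctional m (X ^ j * (X * S.cur - C (σ - S.shift) * S.cur -
        C (h / S.norm) * S.prev)) = 0
      rw [hLcur]
      rcases Nat.lt_succ_iff_lt_or_eq.mp hj with hj | rfl
      · rw [hS.cur_orth j hj]
        rcases (Nat.succ_le_of_lt hj).lt_or_eq with hj' | hj'
        · rw [hS.cur_orth _ hj', hS.prev_orth _ hj']; ring
        · rw [hS.prev_norm _ hj', show j + 1 = k from hj', ← hhdef]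
          field_simp; ring
      · rw [hS.prev_shift, ← hhdef, hσ]
        field_simp; ring
    · intro j hj
      exact hS.cur_orth j (by omega)
    · intro j hj
      obtain rfl : j = k := by omega
      rfl
    · show momentFunctional m (X ^ (k + 1) * S.cur) = σ * h
      rw [hσ]; field_simp

/-! ### The Christoffel–Darboux kernel and the inverse Hankel matrix -/

/-- The Christoffel–Darboux kernel `∑_{k < n} p_k(x) p_k(y) / h_k`, as a polynomial in `x` whose
coefficients are polynomials in `y`. -/
noncomputable def kernel (m : ℕ → ℝ) (n : ℕ) : ℝ[X][X] :=
  ∑ k ∈ Finset.range n, C (C (recurrence m (k + 1)).norm⁻¹) *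
    ((recurrence m k).cur.map C * C (recurrence m k).cur)

theorem coeff_kernel (m : ℕ → ℝ) (n i j : ℕ) :
    ((kernel m n).coeff i).coeff j = ∑ k ∈ Finset.range n,
      (recurrence m k).cur.coeff i * (recurrence m (k + 1)).norm⁻¹ *
        (recurrence m k).cur.coeff j := by
  simp only [kernel, finsetSum_coeff, coeff_C_mul, coeff_mul_C, coeff_map]
  exact Finset.sum_congr rfl fun k _ => by ring

/-- The Christoffel–Darboux formula. -/
theorem sub_mul_kernel {m : ℕ → ℝ} {d : ℕ} (hm : IsPositive m d) (n : ℕ) (hn : n ≤ d + 1) :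
    (X - C X) * kernel m n = C (C (recurrence m n).norm⁻¹) *
      ((recurrence m n).cur.map C * C (recurrence m n).prev -
        (recurrence m n).prev.map C * C (recurrence m n).cur) := by
  induction n with
  | zero => simp [kernel, recurrence]
  | succ n ih =>
    have h0 := (recurrence_orthogonal hm n (by omega)).norm_pos.ne'
    have h1 := (recurrence_orthogonal hm (n + 1) hn).norm_pos.ne'
    rw [kernel, Finset.sum_range_succ, mul_add, ← kernel, ih (by omega)]
    set S := recurrence m n with hS
    have e1 : (recurrence m (n + 1)).prev = S.cur := rfl
    have e2 : (recurrence m (n + 1)).cur = X * S.cur -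
      C ((recurrence m (n + 1)).shift - S.shift) * S.cur -
      C ((recurrence m (n + 1)).norm / S.norm) * S.prev := rfl
    rw [e1, e2]
    set h := (recurrence m (n + 1)).norm
    -- With this rescaling the induction hypothesis cancels the `p_{n-1}` terms, and the `p_n` terms
    -- with the shift coefficient cancel by antisymmetry.
    have e3 : (C (C S.norm⁻¹) : ℝ[X][X]) = C (C h⁻¹) * C (C (h / S.norm)) := by
      rw [← C_mul, ← C_mul]; congr 2; field_simp
    rw [e3]
    simp only [Polynomial.map_sub, Polynomial.map_mul, map_X, map_C, C_sub, C_mul]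
    ring

theorem coeff_kernel_eq_zero {m : ℕ → ℝ} {d : ℕ} (hm : IsPositive m d) (i j : ℕ)
    (h : d < i ∨ d < j) : ((kernel m (d + 1)).coeff i).coeff j = 0 := by
  rw [coeff_kernel]
  refine Finset.sum_eq_zero fun k hk => ?_
  have hk' := Finset.mem_range.mp hk
  have hd := (recurrence_orthogonal hm k hk'.le).natDegree
  rcases h with h | h
  · rw [coeff_eq_zero_of_natDegree_lt (n := i) (by omega)]; ring
  · rw [coeff_eq_zero_of_natDegree_lt (n := j) (by omega)]; ring

/-- The Christoffel–Darboux kernel inverts the Hankel matrix of the moments. -/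
theorem hankel_mul_kernel {m : ℕ → ℝ} {d : ℕ} (hm : IsPositive m d) :
    (Matrix.of fun i j : Fin (d + 1) => m (i + j)) *
      (Matrix.of fun i j : Fin (d + 1) => ((kernel m (d + 1)).coeff i).coeff j) = 1 := by
  set H : Matrix (Fin (d + 1)) (Fin (d + 1)) ℝ := Matrix.of fun i j => m (i + j) with hH
  set P : Matrix (Fin (d + 1)) (Fin (d + 1)) ℝ :=
    Matrix.of fun k i => (recurrence m k).cur.coeff i with hP
  set D : Matrix (Fin (d + 1)) (Fin (d + 1)) ℝ :=
    Matrix.diagonal fun k => (recurrence m (k + 1)).norm⁻¹ with hD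
  have hdeg : ∀ k : Fin (d + 1), (recurrence m k).cur.natDegree = k := fun k =>
    (recurrence_orthogonal hm k (by omega)).natDegree
  have hG : (Matrix.of fun i j : Fin (d + 1) => ((kernel m (d + 1)).coeff i).coeff j) =
      P.transpose * D * P := by
    ext i j
    rw [Matrix.of_apply, coeff_kernel, Finset.sum_range, Matrix.mul_apply]
    refine Finset.sum_congr rfl fun k _ => ?_
    rw [hD, Matrix.mul_diagonal]
    rfl
  have horth : P * H * P.transpose =
      Matrix.diagonal fun k : Fin (d + 1) => (recurrence m (k + 1)).norm := by
    ext k l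
    have h1 : (P * H * P.transpose) k l =
        momentFunctional m ((recurrence m k).cur * (recurrence m l).cur) := by
      rw [momentFunctional_mul m (d + 1) _ _ (by rw [hdeg]; omega) (by rw [hdeg]; omega),
        Finset.sum_comm, Matrix.mul_apply]
      refine Finset.sum_congr rfl fun j _ => ?_
      rw [Matrix.mul_apply, Finset.sum_mul]
      rfl
    rw [h1]
    have hlt : ∀ a b : Fin (d + 1), a < b →
        momentFunctional m ((recurrence m a).cur * (recurrence m b).cur) = 0 := by
      intro a b hab
      refine (recurrence_orthogonal hm b (by omega)).mul_eq_zero _ ?_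
      rw [degree_eq_natDegree (recurrence_orthogonal hm a (by omega)).monic.ne_zero, hdeg]
      exact_mod_cast hab
    rcases lt_trichotomy k l with h | rfl | h
    · rw [hlt _ _ h, Matrix.diagonal_apply_ne _ h.ne]
    · rw [Matrix.diagonal_apply_eq, (recurrence_orthogonal hm k (by omega)).mul_self]
      rfl
    · rw [mul_comm, hlt _ _ h, Matrix.diagonal_apply_ne _ h.ne']
  -- Orthogonality says `P H Pᵀ = D⁻¹`. Since one-sided inverses of square matrices are two-sided,
  -- `P` can be moved to the right end, giving `H (Pᵀ D P) = 1`.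
  have h1 : P * (H * P.transpose * D) = 1 := by
    rw [← mul_assoc, ← mul_assoc, horth, hD, Matrix.diagonal_mul_diagonal, ← Matrix.diagonal_one]
    congr 1
    ext k
    exact mul_inv_cancel₀ (recurrence_orthogonal hm (k + 1) (by omega)).norm_pos.ne'
  rw [hG, ← mul_assoc, ← mul_assoc]
  exact mul_eq_one_comm.mp h1

end OrthogonalPolynomial

namespace RealRAM

/-! ### Hoare-style rules with step bounds -/

/-- The program `P`, started in `s`, halts within `c` steps in a state with property `Q`. -/
def HaltsWithin (P : Program) (s : State) (c : ℕ) (Q : State → Prop) : Prop :=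
  ∃ n s', Runs P s n s' ∧ n ≤ c ∧ Q s'

theorem HaltsWithin.mono {P : Program} {s : State} {c c' : ℕ} {Q Q' : State → Prop}
    (h : HaltsWithin P s c Q) (hc : c ≤ c') (hQ : ∀ s', Q s' → Q' s') :
    HaltsWithin P s c' Q' := by
  obtain ⟨n, s', hr, hn, hs⟩ := h
  exact ⟨n, s', hr, hn.trans hc, hQ s' hs⟩

theorem HaltsWithin.seq {P P' : Program} {s : State} {c c' : ℕ} {Q Q' : State → Prop}
    (h : HaltsWithin P s c Q) (h' : ∀ s', Q s' → HaltsWithin P' s' c' Q') :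
    HaltsWithin (.seq P P') s (c + c') Q' := by
  obtain ⟨n, s', hr, hn, hs⟩ := h
  obtain ⟨n', s'', hr', hn', hs'⟩ := h' s' hs
  exact ⟨n + n', s'', .seq hr hr', add_le_add hn hn', hs'⟩

/-- A loop with invariant `I` which makes `N` passes of at most `c` steps each. -/
theorem HaltsWithin.loop {b : Test} {P : Program} {c : ℕ} (N : ℕ) (I : ℕ → State → Prop)
    (hstep : ∀ k < N, ∀ s, I k s → b.Holds s ∧ HaltsWithin P s c (I (k + 1)))
    (hend : ∀ s, I N s → ¬ b.Holds s) {s : State} (hs : I 0 s) :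
    HaltsWithin (.loop b P) s (N * (c + 1) + 1) (I N) := by
  suffices ∀ j k, j + k = N → ∀ s, I k s → HaltsWithin (.loop b P) s (j * (c + 1) + 1) (I N) from
    this N 0 rfl s hs
  intro j
  induction j with
  | zero =>
    rintro k rfl s hs
    rw [zero_add] at hend ⊢
    exact ⟨1, s, .loop_false (hend s hs), by omega, hs⟩
  | succ j ih =>
    intro k hk s hs
    obtain ⟨hb, n, s', hr, hn, hs'⟩ := hstep k (by omega) s hs
    obtain ⟨n', s'', hr', hn', hs''⟩ := ih (k + 1) (by omega) s' hs'
    exact ⟨n + n' + 1, s'', .loop_true hb hr hr', by rw [add_mul]; omega, hs''⟩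

/-- Straight-line code. -/
def block : List Instr → Program
  | [] => .skip
  | i :: l => .seq (.instr i) (block l)

/-- The effect of straight-line code. -/
noncomputable def execs : List Instr → State → Option State
  | [], s => some s
  | i :: l, s => (i.exec s).bind (execs l)

theorem HaltsWithin.block {l : List Instr} {s s' : State} {Q : State → Prop}
    (h : execs l s = some s') (hQ : Q s') : HaltsWithin (block l) s (l.length + 1) Q := by
  induction l generalizing s with
  | nil =>
    obtain rfl : s = s' := Option.some.inj h
    exact ⟨1, s, .skip s, by simp, hQ⟩
  | cons i l ih =>
    obtain ⟨t, ht, hl⟩ := Option.bind_eq_some_iff.mp h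
    obtain ⟨n, s'', hr, hn, hs⟩ := ih hl
    exact ⟨1 + n, s'', .seq (.instr ht) hr, by rw [List.length_cons]; omega, hs⟩

theorem HaltsWithin.of_execs {l : List Instr} {s : State} {c : ℕ} {Q : State → Prop}
    (hc : l.length + 1 ≤ c) (h : ∃ s', execs l s = some s' ∧ Q s') :
    HaltsWithin (RealRAM.block l) s c Q := by
  obtain ⟨s', h, hQ⟩ := h
  exact (HaltsWithin.block h hQ).mono hc fun _ => id

open OrthogonalPolynomial

/-! ### The program -/

/-- Initialisation of the index bounds and of the recurrence. -/
def setup : Program := block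
  [.iconst 1 1, .iadd 10 0 1, .iadd 2 10 1, .iadd 3 0 10, .iadd 4 10 2,
   .rconst 0 1, .store 3 5 0, .rconst 1 1, .rconst 2 0]

/-- The two moments `L(t ^ k p_k)` and `L(t ^ (k + 1) p_k)`. -/
def momentLoop : Program := .loop (.ilt 6 2) <| block
  [.load 5 3 6, .iadd 7 5 6, .load 6 0 7, .rmul 6 5 6, .radd 3 3 6,
   .iadd 7 7 1, .load 6 0 7, .rmul 6 5 6, .radd 4 4 6, .iadd 6 6 1]

/-- The in-place update of the coefficients of `p_k` and `p_{k-1}`. -/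
def updateLoop : Program := .loop (.ilt 6 2) <| block
  [.load 5 3 6, .load 6 4 6, .rmul 10 7 5, .rsub 9 9 10, .rmul 10 8 6, .rsub 9 9 10,
   .store 3 6 9, .store 4 6 5, .rconst 9 0, .radd 9 5 9, .iadd 6 6 1]

/-- The three-term recurrence. -/
def recurrenceLoop : Program := .loop (.ilt 5 10) <|
  .seq (block [.rconst 3 0, .rconst 4 0, .iconst 6 0]) <|
  .seq momentLoop <|
  .seq (block [.rdiv 4 4 3, .rsub 7 4 2, .rdiv 8 3 1, .rconst 9 0, .radd 1 3 9, .radd 2 4 9,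
    .iconst 6 0]) <|
  .seq updateLoop <|
  block [.iadd 5 5 1]

/-- One coefficient of each of the products `a²`, `b²` and `a b`. -/
def convolutionLoop : Program := .loop (.ilt 6 8) <| block
  [.isub 7 5 6, .load 5 3 6, .load 6 4 6, .load 7 3 7, .load 8 4 7,
   .rmul 9 5 7, .radd 2 2 9, .rmul 9 6 8, .radd 3 3 9, .rmul 9 5 8, .radd 4 4 9, .iadd 6 6 1]

/-- The products `a²`, `b²` and `a b`. -/
def productLoop : Program := .loop (.ilt 5 4) <|
  .seq (block [.rconst 2 0, .rconst 3 0, .rconst 4 0, .iconst 6 0, .iadd 8 5 1]) <|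
  .seq convolutionLoop <|
  block [.store 5 5 2, .store 6 5 3, .store 7 5 4, .iadd 5 5 1]

/-- One row of the Hessian, and its scalar product with the vector of moments. -/
def rowLoop : Program := .loop (.ilt 6 3) <| block
  [.iadd 7 6 1, .load 5 8 7, .iadd 7 7 1, .load 6 9 7,
   .load 7 6 7, .rmul 7 2 7, .load 8 5 7, .rmul 8 3 8, .radd 7 7 8,
   .load 8 7 7, .rmul 8 4 8, .rsub 7 7 8, .rsub 7 7 8, .rdiv 7 7 1,
   .radd 7 7 5, .radd 7 7 5, .rsub 7 7 6,
   .load 8 8 6, .store 9 6 8, .store 8 6 7, .store 2 8 7,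
   .load 8 0 6, .rmul 8 8 7, .rsub 10 10 8, .iadd 8 8 1, .iadd 6 6 1]

/-- The Hessian, row by row, and the gradient. -/
def hessianLoop : Program := .loop (.ilt 5 3) <|
  .seq (block [.load 2 5 5, .load 3 6 5, .load 4 7 5, .rconst 10 0, .iconst 6 0]) <|
  .seq rowLoop <|
  block [.store 1 5 10, .iadd 5 5 1]

/-- The program which computes gradient and Hessian of the barrier. -/
def barrierProgram : Program :=
  .seq setup <| .seq recurrenceLoop <|
  .seq (block [.rmul 1 1 1, .iconst 5 0]) <| .seq productLoop <|
  .seq (block [.iconst 5 0, .iconst 8 0]) hessianLoop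

/-! ### Loop invariants, correctness and cost of the program -/

/-- The sequence which agrees with `f` below `n` and with `g` from `n` on. -/
def splice (f g : ℕ → ℝ) (n : ℕ) : ℕ → ℝ := fun j => if j < n then f j else g j

theorem splice_zero (f g : ℕ → ℝ) : splice f g 0 = g := by
  ext j
  simp [splice]

theorem splice_add (f g : ℕ → ℝ) (n k : ℕ) : splice f g n (n + k) = g (n + k) := by
  simp [splice]

theorem splice_self (f g : ℕ → ℝ) (n : ℕ) : splice f g n n = g n := splice_add f g n 0

theorem splice_eq_left {f g : ℕ → ℝ} {n : ℕ} (h : ∀ j, n ≤ j → g j = f j) : splice f g n = f := by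
  ext j
  by_cases hj : j < n
  · simp [splice, hj]
  · simp [splice, hj, h j (not_lt.mp hj)]

theorem update_splice {f g : ℕ → ℝ} {n : ℕ} {v : ℝ} (hv : v = f n) :
    Function.update (splice f g n) n v = splice f g (n + 1) := by
  ext j
  rcases lt_trichotomy j n with h | rfl | h
  · simp [splice, Function.update_of_ne h.ne, h, h.trans (Nat.lt_succ_self n)]
  · simp [splice, hv]
  · simp [splice, Function.update_of_ne h.ne', h.not_gt, Nat.succ_le_of_lt h |>.not_gt]

/-- The index registers that hold the loop bounds. -/
def Bounds (d : ℕ) (s : State) : Prop :=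
  s.idx 1 = 1 ∧ s.idx 2 = d + 2 ∧ s.idx 3 = 2 * d + 1 ∧ s.idx 4 = 2 * d + 3 ∧ s.idx 10 = d + 1

/-- The state before pass `k` of the recurrence. -/
def RecurrenceInv (m : ℕ → ℝ) (d k : ℕ) (s : State) : Prop :=
  Bounds d s ∧ s.idx 5 = k ∧ s.reg 1 = (recurrence m k).norm ∧ s.reg 2 = (recurrence m k).shift ∧
    s.arr 0 = m ∧ s.arr 3 = (recurrence m k).cur.coeff ∧ s.arr 4 = (recurrence m k).prev.coeff ∧
    s.arr 8 = 0 ∧ s.arr 9 = 0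

theorem setup_spec (m : ℕ → ℝ) (d : ℕ) (s : State) (h0 : s.idx 0 = d) (h5 : s.idx 5 = 0)
    (ha : s.arr 0 = m) (har : ∀ a, a ≠ 0 → s.arr a = 0) :
    HaltsWithin setup s 10 (RecurrenceInv m d 0) := by
  have e1 : Function.update (0 : ℕ → ℝ) 0 1 = (1 : ℝ[X]).coeff := by
    ext i
    simp [Function.update_apply, coeff_one]
  -- Array `4` needs no initialisation: the zero array already represents `p_{-1} = 0`.
  have e2 : (0 : ℝ[X]).coeff = 0 := rfl
  refine HaltsWithin.of_execs (by decide) ?_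
  simp [execs, Instr.exec, RecurrenceInv, Bounds, h0, h5, ha, har, recurrence, e1, e2]
  omega

theorem momentLoop_spec {m : ℕ → ℝ} {d k : ℕ} {s : State} (hs : RecurrenceInv m d k s)
    (h3 : s.reg 3 = 0) (h4 : s.reg 4 = 0) (h6 : s.idx 6 = 0) :
    HaltsWithin momentLoop s ((d + 2) * 12 + 1) fun s' => RecurrenceInv m d k s' ∧
      s'.reg 3 = ∑ i ∈ Finset.range (d + 2), (recurrence m k).cur.coeff i * m (i + k) ∧
      s'.reg 4 = ∑ i ∈ Finset.range (d + 2), (recurrence m k).cur.coeff i * m (i + (k + 1)) := by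
  refine (HaltsWithin.loop (d + 2) (fun n s' => s'.idx 6 = n ∧ RecurrenceInv m d k s' ∧
      s'.reg 3 = ∑ i ∈ Finset.range n, (recurrence m k).cur.coeff i * m (i + k) ∧
      s'.reg 4 = ∑ i ∈ Finset.range n, (recurrence m k).cur.coeff i * m (i + (k + 1)))
    ?_ ?_ ⟨h6, hs, by simpa, by simpa⟩).mono le_rfl fun s' h => h.2
  · rintro n hn s ⟨h6, ⟨⟨i1, i2, i3, i4, i10⟩, i5, r1, r2, a0, a3, a4, a8, a9⟩, h3, h4⟩
    refine ⟨by rw [Test.Holds, h6, i2]; assumption, HaltsWithin.of_execs (by decide) ?_⟩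
    simp [execs, Instr.exec, RecurrenceInv, Bounds, h6, i1, i2, i3, i4, i10, i5, r1, r2, a0, a3, a4,
      a8, a9, h3, h4, Finset.sum_range_succ, add_comm, add_left_comm]
    exact .inl (congrArg m (add_assoc k n 1))
  · rintro s ⟨h6, ⟨⟨i1, i2, -⟩, -⟩, -⟩
    simp [Test.Holds, h6, i2]

theorem coeff_recurrence_succ (m : ℕ → ℝ) (k n : ℕ) :
    (recurrence m (k + 1)).cur.coeff n = (X * (recurrence m k).cur).coeff n -
      ((recurrence m (k + 1)).shift - (recurrence m k).shift) * (recurrence m k).cur.coeff n -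
      (recurrence m (k + 1)).norm / (recurrence m k).norm * (recurrence m k).prev.coeff n := by
  conv_lhs => rw [recurrence]
  simp only [coeff_sub, coeff_C_mul]
  rfl

/-- Because the update is in place, real register `9` saves the old coefficient `n - 1` of `p_k`,
which is coefficient `n` of `X * p_k`. The pass counter is incremented only after this loop, hence
the modified state in the conclusion. -/
theorem updateLoop_spec {m : ℕ → ℝ} {d k : ℕ} (hm : IsPositive m d) (hk : k < d + 1) {s : State}
    (hb : Bounds d s) (i5 : s.idx 5 = k) (i6 : s.idx 6 = 0)
    (r1 : s.reg 1 = (recurrence m (k + 1)).norm) (r2 : s.reg 2 = (recurrence m (k + 1)).shift)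
    (r7 : s.reg 7 = (recurrence m (k + 1)).shift - (recurrence m k).shift)
    (r8 : s.reg 8 = (recurrence m (k + 1)).norm / (recurrence m k).norm) (r9 : s.reg 9 = 0)
    (a0 : s.arr 0 = m) (a3 : s.arr 3 = (recurrence m k).cur.coeff)
    (a4 : s.arr 4 = (recurrence m k).prev.coeff) (a8 : s.arr 8 = 0) (a9 : s.arr 9 = 0) :
    HaltsWithin updateLoop s ((d + 2) * 13 + 1) fun s' => s'.idx 5 = k ∧
      RecurrenceInv m d (k + 1) { s' with idx := Function.update s'.idx 5 (k + 1) } := by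
  refine (HaltsWithin.loop (d + 2) (fun n s' => s'.idx 6 = n ∧ Bounds d s' ∧ s'.idx 5 = k ∧
      s'.reg 1 = (recurrence m (k + 1)).norm ∧ s'.reg 2 = (recurrence m (k + 1)).shift ∧
      s'.reg 7 = (recurrence m (k + 1)).shift - (recurrence m k).shift ∧
      s'.reg 8 = (recurrence m (k + 1)).norm / (recurrence m k).norm ∧
      s'.reg 9 = (X * (recurrence m k).cur).coeff n ∧ s'.arr 0 = m ∧
      s'.arr 3 = splice (recurrence m (k + 1)).cur.coeff (recurrence m k).cur.coeff n ∧
      s'.arr 4 = splice (recurrence m k).cur.coeff (recurrence m k).prev.coeff n ∧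
      s'.arr 8 = 0 ∧ s'.arr 9 = 0)
    ?_ ?_ ⟨i6, hb, i5, r1, r2, r7, r8, by simpa, a0, by rwa [splice_zero], by rwa [splice_zero],
      a8, a9⟩).mono le_rfl ?_
  · rintro n hn s ⟨h6, ⟨i1, i2, i3, i4, i10⟩, i5, r1, r2, r7, r8, r9, a0, a3, a4, a8, a9⟩
    refine ⟨by rw [Test.Holds, h6, i2]; assumption, HaltsWithin.of_execs (by decide) ?_⟩
    simp only [execs, Instr.exec, Option.bind_some, Option.some.injEq, exists_eq_left']
    simp [Bounds, h6, i1, i2, i3, i4, i10, i5, r1, r2, r7, r8, r9, a0, a3, a4, a8, a9,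
      splice_self, coeff_X_mul]
    exact ⟨update_splice (coeff_recurrence_succ m k n).symm, update_splice rfl⟩
  · rintro s ⟨h6, ⟨i1, i2, -⟩, -⟩
    simp [Test.Holds, h6, i2]
  · rintro s ⟨h6, ⟨i1, i2, i3, i4, i10⟩, i5, r1, r2, r7, r8, r9, a0, a3, a4, a8, a9⟩
    have h0 := recurrence_orthogonal hm k hk.le
    have h1 := recurrence_orthogonal hm (k + 1) hk
    -- The `d + 2` cells written are enough: beyond them old and new coefficients vanish by degree.
    rw [splice_eq_left fun j hj => by
      rw [coeff_eq_zero_of_natDegree_lt (h0.natDegree.trans_lt (by omega)),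
        coeff_eq_zero_of_natDegree_lt (h1.natDegree.trans_lt (by omega))]] at a3
    rw [splice_eq_left fun j hj => by
      rw [coeff_eq_zero_of_degree_lt (h0.degree_prev.trans_le (by exact_mod_cast (by omega))),
        coeff_eq_zero_of_natDegree_lt (h0.natDegree.trans_lt (by omega))]] at a4
    simp [RecurrenceInv, Bounds, i1, i2, i3, i4, i10, i5, r1, r2, a0, a3, a4, a8, a9]
    rfl

theorem recurrenceLoop_spec {m : ℕ → ℝ} {d : ℕ} (hm : IsPositive m d) {s : State}
    (hs : RecurrenceInv m d 0 s) :
    HaltsWithin recurrenceLoop s ((d + 1) * ((d + 2) * 40 + 1) + 1)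
      (RecurrenceInv m d (d + 1)) := by
  refine HaltsWithin.loop (d + 1) (RecurrenceInv m d) ?_ ?_ hs
  · rintro k hk s hs
    have hs' := hs
    obtain ⟨⟨i1, i2, i3, i4, i10⟩, i5, r1, r2, a0, a3, a4, a8, a9⟩ := hs'
    refine ⟨by rw [Test.Holds, i5, i10]; assumption, ?_⟩
    have hdeg : (recurrence m k).cur.natDegree < d + 2 := by
      rw [(recurrence_orthogonal hm k hk.le).natDegree]; omega
    have hnorm : (recurrence m (k + 1)).norm ≠ 0 :=
      (recurrence_orthogonal hm (k + 1) hk).norm_pos.ne'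
    have step1 : HaltsWithin (block [.rconst 3 0, .rconst 4 0, .iconst 6 0]) s 4 fun s' =>
        RecurrenceInv m d k s' ∧ s'.reg 3 = 0 ∧ s'.reg 4 = 0 ∧ s'.idx 6 = 0 := by
      refine HaltsWithin.of_execs (by decide) ?_
      simp [execs, Instr.exec, RecurrenceInv, Bounds, i1, i2, i3, i4, i10, i5, r1, r2, a0, a3, a4,
        a8, a9]
    refine (step1.seq fun s' h => (momentLoop_spec h.1 h.2.1 h.2.2.1 h.2.2.2).seq
      (c' := 8 + (((d + 2) * 13 + 1) + 2)) fun s h => ?_).mono (by omega) fun _ => id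
    obtain ⟨⟨⟨i1, i2, i3, i4, i10⟩, i5, r1, r2, a0, a3, a4, a8, a9⟩, h3, h4⟩ := h
    rw [← momentFunctional_X_pow_mul m _ _ _ hdeg] at h3 h4
    replace h3 : s.reg 3 = (recurrence m (k + 1)).norm := h3
    have hshift : momentFunctional m (X ^ (k + 1) * (recurrence m k).cur) /
      (recurrence m (k + 1)).norm = (recurrence m (k + 1)).shift := rfl
    have step3 : HaltsWithin (block [.rdiv 4 4 3, .rsub 7 4 2, .rdiv 8 3 1, .rconst 9 0,
        .radd 1 3 9, .radd 2 4 9, .iconst 6 0]) s 8 fun s' => Bounds d s' ∧ s'.idx 5 = k ∧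
        s'.idx 6 = 0 ∧ s'.reg 1 = (recurrence m (k + 1)).norm ∧
        s'.reg 2 = (recurrence m (k + 1)).shift ∧
        s'.reg 7 = (recurrence m (k + 1)).shift - (recurrence m k).shift ∧
        s'.reg 8 = (recurrence m (k + 1)).norm / (recurrence m k).norm ∧ s'.reg 9 = 0 ∧
        s'.arr 0 = m ∧ s'.arr 3 = (recurrence m k).cur.coeff ∧
        s'.arr 4 = (recurrence m k).prev.coeff ∧ s'.arr 8 = 0 ∧ s'.arr 9 = 0 := by
      refine HaltsWithin.of_execs (by decide) ?_
      simp [execs, Instr.exec, Bounds, i1, i2, i3, i4, i10, i5, r1, r2, a0, a3, a4,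
        a8, a9, h3, h4, hnorm, hshift, (recurrence_orthogonal hm k hk.le).norm_pos.ne']
    refine step3.seq fun s' ⟨hb, i5, i6, r1, r2, r7, r8, r9, a0, a3, a4, a8, a9⟩ =>
      (updateLoop_spec hm hk hb i5 i6 r1 r2 r7 r8 r9 a0 a3 a4 a8 a9).seq fun s' ⟨i5, h⟩ =>
        HaltsWithin.of_execs (by decide) ⟨_, rfl, ?_⟩
    have i1 : s'.idx 1 = 1 := by simpa using h.1.1
    simpa [i1, i5] using h
  · rintro s ⟨⟨i1, i2, i3, i4, i10⟩, i5, -⟩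
    simp [Test.Holds, i5, i10]

/-- The state before pass `u` of the computation of the products `a²`, `b²` and `a b`. -/
def ProductInv (m : ℕ → ℝ) (a b : ℝ[X]) (c : ℝ) (d u : ℕ) (s : State) : Prop :=
  Bounds d s ∧ s.idx 5 = u ∧ s.reg 1 = c ∧ s.arr 0 = m ∧ s.arr 3 = a.coeff ∧ s.arr 4 = b.coeff ∧
    (∀ i < u, s.arr 5 i = (a * a).coeff i) ∧ (∀ i < u, s.arr 6 i = (b * b).coeff i) ∧
    (∀ i < u, s.arr 7 i = (a * b).coeff i) ∧ s.arr 8 = 0 ∧ s.arr 9 = 0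

theorem coeff_mul_eq_sum_range (p q : ℝ[X]) (u : ℕ) :
    (p * q).coeff u = ∑ i ∈ Finset.range (u + 1), p.coeff i * q.coeff (u - i) := by
  rw [coeff_mul, Finset.Nat.sum_antidiagonal_eq_sum_range_succ fun i j => p.coeff i * q.coeff j]

theorem convolutionLoop_spec {m : ℕ → ℝ} {a b : ℝ[X]} {c : ℝ} {d u : ℕ} {s : State}
    (hs : ProductInv m a b c d u s) (r2 : s.reg 2 = 0) (r3 : s.reg 3 = 0) (r4 : s.reg 4 = 0)
    (i6 : s.idx 6 = 0) (i8 : s.idx 8 = u + 1) :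
    HaltsWithin convolutionLoop s ((u + 1) * 14 + 1) fun s' => ProductInv m a b c d u s' ∧
      s'.reg 2 = (a * a).coeff u ∧ s'.reg 3 = (b * b).coeff u ∧ s'.reg 4 = (a * b).coeff u := by
  simp only [coeff_mul_eq_sum_range _ _ u]
  refine (HaltsWithin.loop (u + 1) (fun n s' => s'.idx 6 = n ∧ s'.idx 8 = u + 1 ∧
      ProductInv m a b c d u s' ∧
      s'.reg 2 = ∑ i ∈ Finset.range n, a.coeff i * a.coeff (u - i) ∧
      s'.reg 3 = ∑ i ∈ Finset.range n, b.coeff i * b.coeff (u - i) ∧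
      s'.reg 4 = ∑ i ∈ Finset.range n, a.coeff i * b.coeff (u - i))
    ?_ ?_ ⟨i6, i8, hs, by simpa, by simpa, by simpa⟩).mono le_rfl fun s' h => h.2.2
  · rintro n hn s ⟨i6, i8, ⟨⟨i1, i2, i3, i4, i10⟩, i5, r1, a0, a3, a4, a5, a6, a7, a8, a9⟩,
      r2, r3, r4⟩
    refine ⟨by rw [Test.Holds, i6, i8]; assumption, HaltsWithin.of_execs (by decide) ?_⟩
    simp only [execs, Instr.exec, Option.bind_some, Option.some.injEq, exists_eq_left']
    simp [ProductInv, Bounds, i6, i8, i1, i2, i3, i4, i10, i5, r1, r2, r3, r4, a0, a3, a4,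
      a8, a9, Finset.sum_range_succ]
    exact ⟨a5, a6, a7⟩
  · rintro s ⟨i6, i8, -⟩
    simp [Test.Holds, i6, i8]

theorem update_eq_of_lt_succ {f g : ℕ → ℝ} {n : ℕ} {v : ℝ} (h : ∀ i < n, f i = g i)
    (hv : v = g n) : ∀ i < n + 1, Function.update f n v i = g i := by
  intro i hi
  rcases Nat.lt_succ_iff_lt_or_eq.mp hi with hi | rfl
  · rw [Function.update_of_ne hi.ne, h i hi]
  · rw [Function.update_self, hv]

theorem productLoop_spec {m : ℕ → ℝ} {a b : ℝ[X]} {c : ℝ} {d : ℕ} {s : State}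
    (hs : ProductInv m a b c d 0 s) :
    HaltsWithin productLoop s ((2 * d + 3) * ((2 * d + 3) * 14 + 13) + 1)
      (ProductInv m a b c d (2 * d + 3)) := by
  refine HaltsWithin.loop (2 * d + 3) (ProductInv m a b c d) ?_ ?_ hs
  · rintro u hu s ⟨⟨i1, i2, i3, i4, i10⟩, i5, r1, a0, a3, a4, a5, a6, a7, a8, a9⟩
    refine ⟨by rw [Test.Holds, i5, i4]; assumption, ?_⟩
    have step1 : HaltsWithin (block [.rconst 2 0, .rconst 3 0, .rconst 4 0, .iconst 6 0,
        .iadd 8 5 1]) s 6 fun s' => ProductInv m a b c d u s' ∧ s'.reg 2 = 0 ∧ s'.reg 3 = 0 ∧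
        s'.reg 4 = 0 ∧ s'.idx 6 = 0 ∧ s'.idx 8 = u + 1 := by
      refine HaltsWithin.of_execs (by decide) ?_
      simp only [execs, Instr.exec, Option.bind_some, Option.some.injEq, exists_eq_left']
      simp [ProductInv, Bounds, i1, i2, i3, i4, i10, i5, r1, a0, a3, a4, a8, a9]
      exact ⟨a5, a6, a7⟩
    refine (step1.seq fun s' ⟨h, r2, r3, r4, i6, i8⟩ =>
      (convolutionLoop_spec h r2 r3 r4 i6 i8).seq (c' := 5) fun s ⟨h, r2, r3, r4⟩ =>
        HaltsWithin.of_execs (by decide) ?_).mono (by omega) fun _ => id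
    obtain ⟨⟨i1, i2, i3, i4, i10⟩, i5, r1, a0, a3, a4, a5, a6, a7, a8, a9⟩ := h
    simp only [execs, Instr.exec, Option.bind_some, Option.some.injEq, exists_eq_left']
    simp [ProductInv, Bounds, i1, i2, i3, i4, i10, i5, r1, a0, a3, a4, a8, a9, r2, r3, r4,
      -Order.lt_add_one_iff]
    exact ⟨update_eq_of_lt_succ a5 rfl, update_eq_of_lt_succ a6 rfl, update_eq_of_lt_succ a7 rfl⟩
  · rintro s ⟨⟨i1, i2, i3, i4, i10⟩, i5, -⟩
    simp [Test.Holds, i5, i4]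

/-- The facts about the state which the computation of the Hessian `(Q_{uv})` and of the vector
`-Q m` does not change from one entry of row `u` to the next; `n` is the number of entries of the
Hessian that have been written. -/
def OutputInv (m : ℕ → ℝ) (a b : ℝ[X]) (c : ℝ) (Q : ℝ[X][X]) (d u n : ℕ) (s : State) : Prop :=
  Bounds d s ∧ s.idx 5 = u ∧ s.idx 8 = n ∧ s.reg 1 = c ∧ s.arr 0 = m ∧
    (∀ i < 2 * d + 3, s.arr 5 i = (a * a).coeff i) ∧
    (∀ i < 2 * d + 3, s.arr 6 i = (b * b).coeff i) ∧
    (∀ i < 2 * d + 3, s.arr 7 i = (a * b).coeff i) ∧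
    (∀ i < u, s.arr 1 i = -∑ w ∈ Finset.range (2 * d + 1), m w * (Q.coeff i).coeff w) ∧
    ∀ e < n, s.arr 2 e = (Q.coeff (e / (2 * d + 1))).coeff (e % (2 * d + 1))

/-- `Q` satisfies the recurrence expressing that `(x - y)² Q = (a(x) b(y) - b(x) a(y))² / c`, and
its degree in `y` is at most `2 d`. -/
structure IsQuotient (a b : ℝ[X]) (c : ℝ) (d : ℕ) (Q : ℝ[X][X]) : Prop where
  ne_zero : c ≠ 0
  coeff_coeff : ∀ u w, (Q.coeff u).coeff w =
    ((a * a).coeff u * (b * b).coeff (w + 2) + (b * b).coeff u * (a * a).coeff (w + 2) -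
      (a * b).coeff u * (a * b).coeff (w + 2) - (a * b).coeff u * (a * b).coeff (w + 2)) / c +
      (((X * Q).coeff u).coeff (w + 1) + ((X * Q).coeff u).coeff (w + 1)) -
      ((X ^ 2 * Q).coeff u).coeff (w + 2)
  eq_zero : ∀ u w, 2 * d < w → (Q.coeff u).coeff w = 0

/-- Arrays `8` and `9` hold rows `u - 1` and `u - 2` of `Q`; writing them as rows of `X * Q` and `X
^ 2 * Q` makes them zero at the start. Entry `n` reads cells `n + 1` and `n + 2`, which are still
unmodified, before cell `n` of both buffers is shifted by one row. Index register `8` runs through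
the output consecutively, so no index multiplication is needed. -/
theorem rowLoop_spec {m : ℕ → ℝ} {a b : ℝ[X]} {c : ℝ} {Q : ℝ[X][X]} {d u : ℕ} {s : State}
    (hQ : IsQuotient a b c d Q) (hs : OutputInv m a b c Q d u (u * (2 * d + 1)) s)
    (i6 : s.idx 6 = 0)
    (r2 : s.reg 2 = (a * a).coeff u) (r3 : s.reg 3 = (b * b).coeff u)
    (r4 : s.reg 4 = (a * b).coeff u) (r10 : s.reg 10 = 0)
    (a8 : s.arr 8 = ((X * Q).coeff u).coeff) (a9 : s.arr 9 = ((X ^ 2 * Q).coeff u).coeff) :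
    HaltsWithin rowLoop s ((2 * d + 1) * 28 + 1) fun s' =>
      OutputInv m a b c Q d u (u * (2 * d + 1) + (2 * d + 1)) s' ∧
      s'.reg 10 = -∑ w ∈ Finset.range (2 * d + 1), m w * (Q.coeff u).coeff w ∧
      s'.arr 8 = splice (Q.coeff u).coeff ((X * Q).coeff u).coeff (2 * d + 1) ∧
      s'.arr 9 = splice ((X * Q).coeff u).coeff ((X ^ 2 * Q).coeff u).coeff (2 * d + 1) := by
  refine (HaltsWithin.loop (2 * d + 1) (fun n s' => s'.idx 6 = n ∧
      s'.reg 2 = (a * a).coeff u ∧ s'.reg 3 = (b * b).coeff u ∧ s'.reg 4 = (a * b).coeff u ∧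
      OutputInv m a b c Q d u (u * (2 * d + 1) + n) s' ∧
      s'.reg 10 = -∑ w ∈ Finset.range n, m w * (Q.coeff u).coeff w ∧
      s'.arr 8 = splice (Q.coeff u).coeff ((X * Q).coeff u).coeff n ∧
      s'.arr 9 = splice ((X * Q).coeff u).coeff ((X ^ 2 * Q).coeff u).coeff n)
    ?_ ?_ ⟨i6, r2, r3, r4, hs, by simpa, by rwa [splice_zero], by rwa [splice_zero]⟩).mono le_rfl
    fun s' h => h.2.2.2.2
  · rintro n hn s ⟨i6, r2, r3, r4, ⟨⟨i1, i2, i3, i4, i10⟩, i5, i8, r1, a0, a5, a6, a7, a1, a2⟩,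
      r10, a8, a9⟩
    refine ⟨by rw [Test.Holds, i6, i3]; assumption, HaltsWithin.of_execs (by decide) ?_⟩
    -- The offset `2` comes from the `y²` in `(x - y)²`, and is why `2 * d + 3` product coefficients
    -- are stored.
    have e5 := a5 (n + 2) (by omega)
    have e6 := a6 (n + 2) (by omega)
    have e7 := a7 (n + 2) (by omega)
    have hdiv : (u * (2 * d + 1) + n) / (2 * d + 1) = u := by
      rw [mul_comm, Nat.mul_add_div (by omega), Nat.div_eq_of_lt hn, add_zero]
    have hmod : (u * (2 * d + 1) + n) % (2 * d + 1) = n := by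
      rw [mul_comm, Nat.mul_add_mod, Nat.mod_eq_of_lt hn]
    simp only [execs, Instr.exec, Option.bind_some]
    simp [OutputInv, Bounds, i6, i8, i1, i2, i3, i4, i10, i5, r1, r2, r3, r4, r10, a0, a8, a9,
      e5, e6, e7, add_assoc, hQ.ne_zero]
    rw [splice_self, splice_add, splice_add, ← hQ.coeff_coeff u n, Finset.sum_range_succ]
    exact ⟨⟨a5, a6, a7, a1, update_eq_of_lt_succ
      (n := u * (2 * d + 1) + n)
      (g := fun e => (Q.coeff (e / (2 * d + 1))).coeff (e % (2 * d + 1))) a2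
      (by rw [hdiv, hmod])⟩, by ring, update_splice rfl, update_splice rfl⟩
  · rintro s ⟨i6, -, -, -, ⟨⟨i1, i2, i3, -⟩, -⟩, -⟩
    simp [Test.Holds, i6, i3]

theorem hessianLoop_spec {m : ℕ → ℝ} {a b : ℝ[X]} {c : ℝ} {Q : ℝ[X][X]} {d : ℕ} {s : State}
    (hQ : IsQuotient a b c d Q) (hs : OutputInv m a b c Q d 0 0 s) (a8 : s.arr 8 = 0)
    (a9 : s.arr 9 = 0) :
    HaltsWithin hessianLoop s ((2 * d + 1) * ((2 * d + 1) * 28 + 11) + 1)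
      (OutputInv m a b c Q d (2 * d + 1) ((2 * d + 1) * (2 * d + 1))) := by
  have hX : ∀ R : ℝ[X][X], (∀ u w, 2 * d < w → (R.coeff u).coeff w = 0) →
      ∀ u w, 2 * d < w → ((X * R).coeff u).coeff w = 0 := by
    rintro R hR (_ | u) w hw
    · rw [coeff_X_mul_zero, coeff_zero]
    · rw [coeff_X_mul, hR u w hw]
  refine (HaltsWithin.loop (2 * d + 1) (fun u s' => OutputInv m a b c Q d u (u * (2 * d + 1)) s' ∧
      s'.arr 8 = ((X * Q).coeff u).coeff ∧ s'.arr 9 = ((X ^ 2 * Q).coeff u).coeff)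
    ?_ ?_ ⟨by rwa [zero_mul], ?_, ?_⟩).mono le_rfl fun s' h => h.1
  · rintro u hu s ⟨⟨⟨i1, i2, i3, i4, i10⟩, i5, i8, r1, a0, a5, a6, a7, a1, a2⟩, a8, a9⟩
    refine ⟨by rw [Test.Holds, i5, i3]; assumption, ?_⟩
    have step1 : HaltsWithin (block [.load 2 5 5, .load 3 6 5, .load 4 7 5, .rconst 10 0,
        .iconst 6 0]) s 6 fun s' => OutputInv m a b c Q d u (u * (2 * d + 1)) s' ∧
        s'.idx 6 = 0 ∧ s'.reg 2 = (a * a).coeff u ∧ s'.reg 3 = (b * b).coeff u ∧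
        s'.reg 4 = (a * b).coeff u ∧ s'.reg 10 = 0 ∧ s'.arr 8 = ((X * Q).coeff u).coeff ∧
        s'.arr 9 = ((X ^ 2 * Q).coeff u).coeff := by
      refine HaltsWithin.of_execs (by decide) ?_
      simp only [execs, Instr.exec, Option.bind_some, Option.some.injEq, exists_eq_left']
      simp [OutputInv, Bounds, i1, i2, i3, i4, i10, i5, i8, r1, a0, a8, a9, a5 u (by omega),
        a6 u (by omega), a7 u (by omega)]
      exact ⟨a5, a6, a7, a1, a2⟩
    refine (step1.seq fun s' ⟨h, i6, r2, r3, r4, r10, a8, a9⟩ =>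
      (rowLoop_spec hQ h i6 r2 r3 r4 r10 a8 a9).seq (c' := 3) fun s ⟨h, r10, a8, a9⟩ =>
        HaltsWithin.of_execs (by decide) ?_).mono (by omega) fun _ => id
    obtain ⟨⟨i1, i2, i3, i4, i10⟩, i5, i8, r1, a0, a5, a6, a7, a1, a2⟩ := h
    -- Cells from `2 * d + 1` on are never written, but all rows vanish there.
    rw [splice_eq_left fun j hj => by rw [hX _ hQ.eq_zero u j hj, hQ.eq_zero u j hj]] at a8
    rw [splice_eq_left fun j hj => by
      rw [hX _ hQ.eq_zero u j hj, pow_succ', pow_one, mul_assoc,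
        hX _ (hX _ hQ.eq_zero) u j hj]] at a9
    · simp only [execs, Instr.exec, Option.bind_some, Option.some.injEq, exists_eq_left']
      simp [OutputInv, Bounds, i1, i2, i3, i4, i10, i5, i8, r1, a0, a8, a9, r10, pow_succ',
        mul_assoc, coeff_X_mul, add_mul, -Order.lt_add_one_iff]
      exact ⟨a5, a6, a7, update_eq_of_lt_succ
        (g := fun i => -∑ w ∈ Finset.range (2 * d + 1), m w * (Q.coeff i).coeff w) a1 rfl, a2⟩
  · rintro s ⟨⟨⟨i1, i2, i3, i4, i10⟩, i5, -⟩, -⟩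
    simp [Test.Holds, i5, i3]
  · rw [a8, coeff_X_mul_zero]
    rfl
  · rw [a9, pow_succ', mul_assoc, coeff_X_mul_zero]
    rfl

theorem barrierProgram_spec {m : ℕ → ℝ} {d : ℕ} (hm : IsPositive m d) {Q : ℝ[X][X]}
    (hQ : IsQuotient (recurrence m (d + 1)).cur (recurrence m (d + 1)).prev
      ((recurrence m (d + 1)).norm * (recurrence m (d + 1)).norm) d Q) {s : State}
    (h0 : s.idx 0 = d) (h5 : s.idx 5 = 0) (ha : s.arr 0 = m) (har : ∀ a, a ≠ 0 → s.arr a = 0) :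
    HaltsWithin barrierProgram s (400 * (d + 2) ^ 2) fun s' =>
      (∀ u < 2 * d + 1,
        s'.arr 1 u = -∑ w ∈ Finset.range (2 * d + 1), m w * (Q.coeff u).coeff w) ∧
      ∀ u < 2 * d + 1, ∀ v < 2 * d + 1,
        s'.arr 2 (u * (2 * d + 1) + v) = (Q.coeff u).coeff v := by
  set S := recurrence m (d + 1)
  have square : ∀ s, RecurrenceInv m d (d + 1) s →
      HaltsWithin (block [.rmul 1 1 1, .iconst 5 0]) s 3
        (ProductInv m S.cur S.prev (S.norm * S.norm) d 0) := by
    rintro s ⟨⟨i1, i2, i3, i4, i10⟩, i5, r1, r2, a0, a3, a4, a8, a9⟩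
    refine HaltsWithin.of_execs (by decide) ?_
    simp [execs, Instr.exec, ProductInv, Bounds, i1, i2, i3, i4, i10, r1, a0, a3, a4, a8, a9, S]
  have reset : ∀ s, ProductInv m S.cur S.prev (S.norm * S.norm) d (2 * d + 3) s →
      HaltsWithin (block [.iconst 5 0, .iconst 8 0]) s 3 fun s' =>
        OutputInv m S.cur S.prev (S.norm * S.norm) Q d 0 0 s' ∧ s'.arr 8 = 0 ∧ s'.arr 9 = 0 := by
    rintro s ⟨⟨i1, i2, i3, i4, i10⟩, i5, r1, a0, a3, a4, a5, a6, a7, a8, a9⟩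
    refine HaltsWithin.of_execs (by decide) ?_
    simp only [execs, Instr.exec, Option.bind_some, Option.some.injEq, exists_eq_left']
    simp [OutputInv, Bounds, i1, i2, i3, i4, i10, r1, a0, a8, a9]
    exact ⟨a5, a6, a7⟩
  refine ((setup_spec m d s h0 h5 ha har).seq fun s hs => (recurrenceLoop_spec hm hs).seq
    fun s hs => (square s hs).seq fun s hs => (productLoop_spec hs).seq fun s hs =>
      (reset s hs).seq fun s hs => hessianLoop_spec hQ hs.1 hs.2.1 hs.2.2).mono ?_ ?_
  -- The loop bounds have total leading coefficient `40 + 56 + 112 = 208`; `400` leaves room for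
  -- lower-order terms.
  · ring_nf
    nlinarith
  · rintro s ⟨-, -, -, -, -, -, -, -, a1, a2⟩
    refine ⟨a1, fun u hu v hv => ?_⟩
    rw [a2 _ (by nlinarith), mul_comm, Nat.mul_add_div (by omega), Nat.div_eq_of_lt hv, add_zero,
      Nat.mul_add_mod, Nat.mod_eq_of_lt hv]

end RealRAM

namespace SOSBarrier

open OrthogonalPolynomial Filter Topology

/-! ### Derivatives of the logarithmic barrier -/

theorem continuous_operator {ι κ : Type*} [Finite κ] (Λ : (κ → ℝ) →ₗ[ℝ] Matrix ι ι ℝ) :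
    Continuous Λ := Λ.continuous_of_finiteDimensional

section Calculus

variable {ι κ : Type*} [Fintype ι] [DecidableEq ι] (Λ : (κ → ℝ) →ₗ[ℝ] Matrix ι ι ℝ)

/-- Jacobi's formula for the logarithm of the determinant. -/
theorem hasLineDerivAt_barrier {x : κ → ℝ} (hx : (Λ x).det ≠ 0) (v : κ → ℝ) :
    HasLineDerivAt ℝ (barrier Λ) (-((Λ x)⁻¹ * Λ v).trace) x v := by
  have hdet : ∀ t : ℝ, (Λ (x + t • v)).det = (Λ x).det * (1 + t • ((Λ x)⁻¹ * Λ v)).det := by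
    intro t
    rw [← Matrix.det_mul, mul_add, mul_one, mul_smul_comm,
      Matrix.mul_nonsing_inv_cancel_left _ _ (isUnit_iff_ne_zero.mpr hx), map_add, map_smul]
  set N := (Λ x)⁻¹ * Λ v
  have h1 : HasDerivAt (fun t : ℝ => (1 + t • N).det) N.trace 0 := by
    -- This expands the determinant as `1 + t tr N + t² q(t)` with `q` a polynomial.
    rw [funext fun t : ℝ => Matrix.det_one_add_smul t N]
    set q := (1 + (X : ℝ[X]) • N.map C).det.divX.divX
    have := (((hasDerivAt_id (0 : ℝ)).const_mul N.trace).const_add 1).add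
      ((q.hasDerivAt 0).mul ((hasDerivAt_id (0 : ℝ)).pow 2))
    exact this.congr_deriv (by simp)
  have h2 := ((h1.const_mul (Λ x).det).log (by simpa using hx)).neg
  refine h2.congr_deriv ?_ |>.congr_of_eventuallyEq (Eventually.of_forall fun t => ?_)
  · simp [hx]
  · show -Real.log _ = -Real.log _
    rw [hdet]

theorem grad_barrier [DecidableEq κ] {x : κ → ℝ} (hx : (Λ x).det ≠ 0) (u : κ) :
    grad (barrier Λ) x u = -((Λ x)⁻¹ * Λ (Pi.single u 1)).trace :=
  (hasLineDerivAt_barrier Λ hx _).lineDeriv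

variable [Fintype κ]

theorem isOpen_det_ne_zero : IsOpen {x | (Λ x).det ≠ 0} :=
  isOpen_ne_fun (continuous_operator Λ).matrix_det continuous_const

theorem contDiff_det : ContDiff ℝ 2 fun x => (Λ x).det := by
  simp only [Matrix.det_apply]
  refine ContDiff.sum fun σ _ => ContDiff.const_smul _ (contDiff_prod fun i _ => ?_)
  exact (LinearMap.toContinuousLinearMap
    ((LinearMap.proj i ∘ₗ LinearMap.proj (σ i)) ∘ₗ (Λ : (κ → ℝ) →ₗ[ℝ] ι → ι → ℝ))).contDiff

theorem contDiffOn_barrier {s : Set (κ → ℝ)} (hs : ∀ x ∈ s, (Λ x).det ≠ 0) :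
    ContDiffOn ℝ 2 (barrier Λ) s :=
  ((contDiff_det Λ).contDiffOn.log hs).neg

/-- By the resolvent identity `A_t⁻¹ - A⁻¹ = -t A_t⁻¹ (Λ v) A⁻¹`, the difference quotient is a
continuous function of `A_t⁻¹`, so only continuity of inversion is needed. -/
theorem hasLineDerivAt_trace_inv_mul {x : κ → ℝ} (hx : (Λ x).det ≠ 0) (v : κ → ℝ)
    (B : Matrix ι ι ℝ) :
    HasLineDerivAt ℝ (fun y => ((Λ y)⁻¹ * B).trace)
      (-((Λ x)⁻¹ * Λ v * ((Λ x)⁻¹ * B)).trace) x v := by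
  have hline : Continuous fun t : ℝ => x + t • v := by fun_prop
  have hlim : Tendsto (fun t : ℝ => x + t • v) (𝓝 0) (𝓝 x) := by
    simpa using hline.tendsto 0
  have hinv : Tendsto (fun t : ℝ => (Λ (x + t • v))⁻¹) (𝓝 0) (𝓝 (Λ x)⁻¹) := by
    have h1 : ContinuousAt Ring.inverse (Λ x).det := by
      rw [Ring.inverse_eq_inv']
      exact continuousAt_inv₀ hx
    exact (continuousAt_matrix_inv _ h1).tendsto.comp
      (((continuous_operator Λ).tendsto x).comp hlim)
  have hev : ∀ᶠ t : ℝ in 𝓝[≠] 0, (Λ (x + t • v)).det ≠ 0 :=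
    ((hlim.eventually ((isOpen_det_ne_zero Λ).mem_nhds hx)).filter_mono nhdsWithin_le_nhds)
  have hcont : Continuous fun M : Matrix ι ι ℝ => -(M * Λ v * ((Λ x)⁻¹ * B)).trace := by
    fun_prop
  rw [HasLineDerivAt, hasDerivAt_iff_tendsto_slope_zero]
  refine ((hcont.tendsto _).comp (hinv.mono_left nhdsWithin_le_nhds)).congr' ?_
  filter_upwards [hev, self_mem_nhdsWithin] with t ht ht0
  have key : (Λ (x + t • v))⁻¹ - (Λ x)⁻¹ = -(t • ((Λ (x + t • v))⁻¹ * Λ v * (Λ x)⁻¹)) := by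
    have e : t • Λ v = Λ (x + t • v) - Λ x := by rw [map_add, map_smul]; abel
    rw [← smul_mul_assoc, ← mul_smul_comm, e, mul_sub, sub_mul,
      Matrix.nonsing_inv_mul _ (isUnit_iff_ne_zero.mpr ht), one_mul, mul_assoc,
      Matrix.mul_nonsing_inv _ (isUnit_iff_ne_zero.mpr hx), mul_one, neg_sub]
  simp only [Function.comp_apply, zero_add, zero_smul, add_zero]
  rw [← Matrix.trace_sub, ← sub_mul, key, neg_mul, Matrix.trace_neg, smul_mul_assoc,
    Matrix.trace_smul, smul_neg, inv_smul_smul₀ ht0, mul_assoc, mul_assoc, mul_assoc]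

variable [DecidableEq κ]

theorem hess_barrier {x : κ → ℝ} (hx : (Λ x).det ≠ 0) (u v : κ) :
    hess (barrier Λ) x u v =
      ((Λ x)⁻¹ * Λ (Pi.single u 1) * ((Λ x)⁻¹ * Λ (Pi.single v 1))).trace := by
  have h : partialDeriv v (barrier Λ) =ᶠ[𝓝 x] fun y => -((Λ y)⁻¹ * Λ (Pi.single v 1)).trace := by
    filter_upwards [(isOpen_det_ne_zero Λ).mem_nhds hx] with y hy using grad_barrier Λ hy v
  rw [hess, Matrix.of_apply, partialDeriv, h.lineDeriv_eq]
  have := (hasLineDerivAt_trace_inv_mul Λ hx (Pi.single u 1) (Λ (Pi.single v 1)))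
  have h2 : HasLineDerivAt ℝ (fun y => -((Λ y)⁻¹ * Λ (Pi.single v 1)).trace)
      (((Λ x)⁻¹ * Λ (Pi.single u 1) * ((Λ x)⁻¹ * Λ (Pi.single v 1))).trace) x (Pi.single u 1) := by
    simpa [HasLineDerivAt] using HasDerivAt.fun_neg this
  exact h2.lineDeriv

/-- Euler's relation: the barrier is logarithmically homogeneous. -/
theorem grad_barrier_eq_sum {x : κ → ℝ} (hx : (Λ x).det ≠ 0) (u : κ) :
    grad (barrier Λ) x u = -∑ v, x v * hess (barrier Λ) x u v := by
  -- Summing the Hessian row against `x` replaces the second direction by `Λ x`, which cancels one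
  -- inverse.
  have h : ∑ v, x v • Λ (Pi.single v 1) = Λ x := by
    conv_rhs => rw [← Finset.univ_sum_single x]
    rw [map_sum]
    refine Finset.sum_congr rfl fun v _ => ?_
    rw [← map_smul, ← Pi.single_smul, smul_eq_mul, mul_one]
  rw [grad_barrier Λ hx]
  simp only [hess_barrier Λ hx]
  congr 1
  simp only [← smul_eq_mul (a := x _), ← Matrix.trace_smul, ← Matrix.trace_sum,
    ← Matrix.mul_smul, ← Finset.mul_sum]
  rw [h, Matrix.nonsing_inv_mul _ (isUnit_iff_ne_zero.mpr hx), mul_one]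

end Calculus

/-! ### The Hankel operator and the dual cone -/

/-- The Hankel operator, as a linear map. -/
def hankelMap (d : ℕ) : (Fin (2 * d + 1) → ℝ) →ₗ[ℝ] Matrix (Fin (d + 1)) (Fin (d + 1)) ℝ where
  toFun := hankel d
  map_add' _ _ := rfl
  map_smul' _ _ := rfl

/-- The moment curve spans: a linear functional vanishing on all `(1, t, …, t^{2d})` is a polynomial
in `t` that is identically zero, so its coefficients vanish. This applies to each entry of `Λ -
hankel d`. -/
theorem isSOSOperator_iff (d : ℕ)
    (Λ : (Fin (2 * d + 1) → ℝ) →ₗ[ℝ] Matrix (Fin (d + 1)) (Fin (d + 1)) ℝ) :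
    IsSOSOperator (monomials d) (monomials (2 * d)) Λ ↔ ∀ x, Λ x = hankel d x := by
  constructor
  · intro h x
    suffices Λ = hankelMap d by rw [this]; rfl
    refine LinearMap.pi_ext' fun u => LinearMap.ext_ring ?_
    ext i j
    let ℓ : (Fin (2 * d + 1) → ℝ) →ₗ[ℝ] ℝ :=
      { toFun := fun y => Λ y i j - hankel d y i j
        map_add' := fun y z => by
          rw [map_add, Matrix.add_apply]
          exact add_sub_add_comm _ _ _ _
        map_smul' := fun c y => by
          rw [map_smul, Matrix.smul_apply]
          exact (mul_sub _ _ _).symm }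
    have hzero : ∀ t : ℝ, ℓ (fun u => t ^ (u : ℕ)) = 0 := by
      intro t
      have ht := congrFun₂ (h t) i j
      simp only [monomials, eval_pow, eval_X, Matrix.vecMulVec_apply] at ht
      show Λ _ i j - hankel d _ i j = 0
      rw [ht, hankel, Matrix.of_apply, pow_add, sub_self]
    have hpoly : (∑ v : Fin (2 * d + 1), monomial (v : ℕ) (ℓ (Pi.single v 1)) : ℝ[X]) = 0 := by
      refine Polynomial.funext fun t => ?_
      rw [eval_zero, ← hzero t, eval_finsetSum]
      conv_rhs => rw [← Finset.univ_sum_single (fun u : Fin (2 * d + 1) => t ^ (u : ℕ)), map_sum]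
      refine Finset.sum_congr rfl fun v _ => ?_
      rw [eval_monomial, mul_comm, ← smul_eq_mul, ← map_smul, ← Pi.single_smul, smul_eq_mul,
        mul_one]
    have hu := congrArg (fun p : ℝ[X] => p.coeff u) hpoly
    simp only [finsetSum_coeff, coeff_monomial, Fin.val_inj, Finset.sum_ite_eq',
      Finset.mem_univ, if_true, coeff_zero] at hu
    exact sub_eq_zero.mp hu
  · intro h t
    rw [h]
    ext i j
    simp [hankel, monomials, Matrix.vecMulVec_apply, pow_add]

/-- The moment sequence of a vector, continued by zeros. -/
def moments {n : ℕ} (x : Fin n → ℝ) : ℕ → ℝ := fun k => if h : k < n then x ⟨k, h⟩ else 0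

theorem moments_apply {n : ℕ} (x : Fin n → ℝ) (u : Fin n) : moments x u = x u := by
  simp [moments]

theorem hankel_eq_moments (d : ℕ) (x : Fin (2 * d + 1) → ℝ) :
    hankel d x = Matrix.of fun i j : Fin (d + 1) => moments x (i + j) := by
  ext i j
  rw [hankel, Matrix.of_apply, Matrix.of_apply, ← moments_apply x]

/-- With `s` the coefficient vector of `p²`, the point `x - t s` stays in the dual cone for some `t
> 0`. Pairing it with `s` gives `s · x ≥ t (s · s) > 0`. -/
theorem isPositive_of_mem_barrierDomain {d : ℕ} {x : Fin (2 * d + 1) → ℝ}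
    (hx : x ∈ barrierDomain d) : IsPositive (moments x) d := by
  intro p hp0 hp
  have hdeg : (p * p).natDegree < 2 * d + 1 := by
    have := natDegree_mul_le (p := p) (q := p)
    omega
  set s : Fin (2 * d + 1) → ℝ := fun u => (p * p).coeff u with hs
  have hsum : ∑ u, s u • monomials (2 * d) u = p * p := by
    conv_rhs => rw [(p * p).as_sum_range' _ hdeg, Finset.sum_range]
    refine Finset.sum_congr rfl fun u _ => ?_
    rw [monomials, smul_X_eq_monomial]
  have hmem : s ∈ sosCone d (monomials (2 * d)) := by
    refine ⟨1, fun _ => p, fun _ => ?_, ?_⟩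
    · exact mem_degreeLE.mpr (natDegree_le_iff_degree_le.mp hp)
    · rw [hsum, Fin.sum_univ_one, sq]
  have hs0 : s ≠ 0 := by
    intro h
    rw [h] at hsum
    simp only [Pi.zero_apply, zero_smul, Finset.sum_const_zero] at hsum
    exact hp0 (mul_self_eq_zero.mp hsum.symm)
  have hss : 0 < s ⬝ᵥ s := by
    have h0 : 0 ≤ s ⬝ᵥ s := Finset.sum_nonneg fun u _ => mul_self_nonneg _
    exact h0.lt_of_ne' fun h => hs0 (dotProduct_self_eq_zero.mp h)
  have hline : Continuous fun t : ℝ => x - t • s := by fun_prop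
  have hnear : ∀ᶠ t : ℝ in 𝓝[>] 0, x - t • s ∈ dualCone (sosCone d (monomials (2 * d))) := by
    have : Tendsto (fun t : ℝ => x - t • s) (𝓝[>] 0) (𝓝 x) := by
      simpa using (hline.tendsto 0).mono_left nhdsWithin_le_nhds
    exact this.eventually (mem_interior_iff_mem_nhds.mp hx)
  obtain ⟨t, ht, ht0⟩ := (hnear.and self_mem_nhdsWithin).exists
  have h := ht s hmem
  rw [dotProduct_sub, dotProduct_smul, smul_eq_mul] at h
  have hL := momentFunctional_X_pow_mul (moments x) 0 _ (p * p) hdeg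
  rw [pow_zero, one_mul] at hL
  rw [hL, Finset.sum_range]
  have hdot : ∑ u : Fin (2 * d + 1), (p * p).coeff u * moments x (u + 0) = s ⬝ᵥ x :=
    Finset.sum_congr rfl fun u _ => by rw [add_zero, moments_apply]
  rw [hdot]
  have := mul_pos (show 0 < t from ht0) hss
  linarith

/-- The quadratic form of the Hankel matrix at `c` is `L(p²)`, where `p` has coefficient vector `c`.
-/
theorem posDef_hankel {d : ℕ} {x : Fin (2 * d + 1) → ℝ} (hx : IsPositive (moments x) d) :
    (hankel d x).PosDef := by
  refine Matrix.PosDef.of_dotProduct_mulVec_pos ?_ fun c hc => ?_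
  · ext i j
    simp [hankel, add_comm]
  · set p : ℝ[X] := ∑ i : Fin (d + 1), monomial (i : ℕ) (c i) with hp
    have hcoeff : ∀ i : Fin (d + 1), p.coeff i = c i := by
      intro i
      simp [hp, finsetSum_coeff, coeff_monomial, Fin.val_inj]
    have hdeg : p.natDegree < d + 1 := by
      refine Nat.lt_succ_of_le (natDegree_sum_le_of_forall_le _ _ fun i _ => ?_)
      exact (natDegree_monomial_le _).trans (by omega)
    have hp0 : p ≠ 0 := by
      rintro h
      exact hc (funext fun i => by rw [← hcoeff, h, coeff_zero, Pi.zero_apply])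
    have := hx p hp0 (by omega)
    rw [momentFunctional_mul _ _ _ _ hdeg hdeg] at this
    simpa only [hcoeff, dotProduct, Matrix.mulVec, Finset.mul_sum, hankel_eq_moments,
      Matrix.of_apply, star_trivial, mul_assoc] using this

/-! ### The Hessian as the squared kernel -/

theorem coeff_mul_eq_sum_fin {R : Type*} [CommSemiring R] {d : ℕ} (p q : R[X])
    (hp : p.natDegree < d) (hq : q.natDegree < d) (u : ℕ) :
    (p * q).coeff u = ∑ a : Fin d, ∑ b : Fin d,
      if (a : ℕ) + b = u then p.coeff a * q.coeff b else 0 := by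
  conv_lhs => rw [p.as_sum_range' d hp, q.as_sum_range' d hq]
  rw [Finset.sum_range, Finset.sum_range, Finset.sum_mul_sum]
  simp only [finsetSum_coeff, monomial_mul_monomial, coeff_monomial]

theorem natDegree_kernel {m : ℕ → ℝ} {d : ℕ} (hm : IsPositive m d) :
    (kernel m (d + 1)).natDegree < d + 1 :=
  Nat.lt_succ_of_le <| natDegree_le_iff_coeff_eq_zero.mpr fun i hi => by
    ext j
    rw [coeff_zero]
    exact coeff_kernel_eq_zero hm i j (.inl hi)

theorem natDegree_coeff_kernel {m : ℕ → ℝ} {d : ℕ} (hm : IsPositive m d) (i : ℕ) :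
    ((kernel m (d + 1)).coeff i).natDegree < d + 1 :=
  Nat.lt_succ_of_le <| natDegree_le_iff_coeff_eq_zero.mpr fun j hj =>
    coeff_kernel_eq_zero hm i j (.inr hj)

theorem coeff_kernel_comm (m : ℕ → ℝ) (n i j : ℕ) :
    ((kernel m n).coeff i).coeff j = ((kernel m n).coeff j).coeff i := by
  rw [coeff_kernel, coeff_kernel]
  exact Finset.sum_congr rfl fun k _ => by ring

theorem coeff_kernel_mul_kernel {m : ℕ → ℝ} {d : ℕ} (hm : IsPositive m d) (u v : ℕ) :
    ((kernel m (d + 1) * kernel m (d + 1)).coeff u).coeff v =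
      ∑ a : Fin (d + 1), ∑ b : Fin (d + 1), ∑ c : Fin (d + 1), ∑ e : Fin (d + 1),
        if (a : ℕ) + b = u then if (c : ℕ) + e = v then
          ((kernel m (d + 1)).coeff a).coeff c * ((kernel m (d + 1)).coeff b).coeff e
        else 0 else 0 := by
  rw [coeff_mul_eq_sum_fin _ _ (natDegree_kernel hm) (natDegree_kernel hm)]
  simp only [finsetSum_coeff]
  refine Finset.sum_congr rfl fun a _ => Finset.sum_congr rfl fun b _ => ?_
  split_ifs
  · exact coeff_mul_eq_sum_fin _ _ (natDegree_coeff_kernel hm _) (natDegree_coeff_kernel hm _) v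
  · simp

theorem hankel_single (d : ℕ) (u : Fin (2 * d + 1)) (i j : Fin (d + 1)) :
    hankel d (Pi.single u 1) i j = if (i : ℕ) + j = u then 1 else 0 := by
  simp [hankel, Pi.single_apply, Fin.ext_iff]

/-- The Hessian of the barrier is the coefficient matrix of the squared kernel. -/
theorem hess_barrier_eq_coeff {d : ℕ}
    {Λ : (Fin (2 * d + 1) → ℝ) →ₗ[ℝ] Matrix (Fin (d + 1)) (Fin (d + 1)) ℝ}
    (hΛ : ∀ x, Λ x = hankel d x) {x : Fin (2 * d + 1) → ℝ} (hx : IsPositive (moments x) d)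
    (u v : Fin (2 * d + 1)) :
    hess (barrier Λ) x u v =
      ((kernel (moments x) (d + 1) * kernel (moments x) (d + 1)).coeff u).coeff v := by
  have hinv : (Λ x)⁻¹ = Matrix.of fun i j : Fin (d + 1) =>
      ((kernel (moments x) (d + 1)).coeff i).coeff j := by
    rw [hΛ]
    refine Matrix.inv_eq_right_inv ?_
    rw [hankel_eq_moments]
    exact hankel_mul_kernel hx
  rw [hess_barrier Λ (by rw [hΛ]; exact (posDef_hankel hx).det_pos.ne'), hinv,
    coeff_kernel_mul_kernel hx, Matrix.trace]
  simp only [Matrix.diag_apply, Matrix.mul_apply, Matrix.of_apply, hΛ, hankel_single, mul_ite,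
    mul_one, mul_zero, Finset.sum_mul_sum, ite_mul, zero_mul]
  set K := kernel (moments x) (d + 1) with hK
  calc _ = ∑ a : Fin (d + 1), ∑ c : Fin (d + 1), ∑ b : Fin (d + 1), ∑ e : Fin (d + 1),
        (if (b : ℕ) + c = u then if (a : ℕ) + e = v then
          (K.coeff b).coeff a * (K.coeff c).coeff e else 0 else 0) := by
        refine Finset.sum_congr rfl fun a _ => Finset.sum_congr rfl fun c _ =>
          Finset.sum_congr rfl fun b _ => Finset.sum_congr rfl fun e _ => ?_
        -- Symmetry of the kernel puts the two indices constrained by `u` in the `x` slot and those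
        -- constrained by `v` in the `y` slot.
        rw [add_comm (e : ℕ), hK, coeff_kernel_comm _ _ a b]
        split_ifs <;> rfl
    _ = ∑ a : Fin (d + 1), ∑ b : Fin (d + 1), ∑ c : Fin (d + 1), ∑ e : Fin (d + 1), _ :=
        Finset.sum_congr rfl fun a _ => Finset.sum_comm
    _ = ∑ b : Fin (d + 1), ∑ a : Fin (d + 1), ∑ c : Fin (d + 1), ∑ e : Fin (d + 1), _ :=
        Finset.sum_comm
    _ = _ := Finset.sum_congr rfl fun b _ => Finset.sum_comm

end SOSBarrier

-- The recurrence is the coefficient of `x^u y^(w+2)` in the square of the Christoffel–Darboux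
-- formula, solved for the contribution of `y² K²`.
open OrthogonalPolynomial in
theorem RealRAM.isQuotient_kernel {m : ℕ → ℝ} {d : ℕ} (hm : IsPositive m d) :
    IsQuotient (recurrence m (d + 1)).cur (recurrence m (d + 1)).prev
      ((recurrence m (d + 1)).norm * (recurrence m (d + 1)).norm) d
      (kernel m (d + 1) * kernel m (d + 1)) := by
  have hn := (recurrence_orthogonal hm (d + 1) le_rfl).norm_pos.ne'
  have hCD := sub_mul_kernel hm (d + 1) le_rfl
  set S := recurrence m (d + 1)
  set K := kernel m (d + 1)
  refine ⟨mul_ne_zero hn hn, fun u w => ?_, fun u w hw => ?_⟩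
  · have hsq : X ^ 2 * (K * K) - C X * (X * (K * K)) - C X * (X * (K * K)) + C (X ^ 2) * (K * K) =
        C (C (S.norm * S.norm)⁻¹) * ((S.cur * S.cur).map C * C (S.prev * S.prev) +
          (S.prev * S.prev).map C * C (S.cur * S.cur) -
          (S.cur * S.prev).map C * C (S.cur * S.prev) -
          (S.cur * S.prev).map C * C (S.cur * S.prev)) := by
      have h := congrArg (fun P => P * P) hCD
      simp only [mul_inv, C_mul, C_pow, Polynomial.map_mul]
      linear_combination h
    have h := congrArg (fun P : ℝ[X][X] => (P.coeff u).coeff (w + 2)) hsq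
    simp only [coeff_add, coeff_sub, coeff_C_mul, coeff_mul_C, coeff_map, coeff_X_mul,
      coeff_X_pow_mul] at h
    rw [div_eq_inv_mul]
    linear_combination h
  · rw [SOSBarrier.coeff_kernel_mul_kernel hm]
    refine Finset.sum_eq_zero fun a _ => Finset.sum_eq_zero fun b _ => Finset.sum_eq_zero
      fun c _ => Finset.sum_eq_zero fun e _ => ?_
    rw [if_neg (show ¬ (c : ℕ) + e = w by omega), ite_self]

/-! ### The time bound and the conclusion -/

theorem isBigO_sq_log (C : ℕ) : Asymptotics.IsBigO Filter.atTop
    (fun d : ℕ => ((C * (d + 2) ^ 2 : ℕ) : ℝ)) (fun d : ℕ => (d : ℝ) ^ 2 * Real.log (d : ℝ)) := by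
  refine Asymptotics.IsBigO.of_bound (4 * C) ?_
  filter_upwards [Filter.eventually_ge_atTop 3] with d hd
  have hd' : (3 : ℝ) ≤ d := by exact_mod_cast hd
  have hlog : 1 ≤ Real.log d := by
    rw [Real.le_log_iff_exp_le (by linarith)]
    exact Real.exp_one_lt_three.le.trans hd'
  rw [Real.norm_of_nonneg (by positivity), Real.norm_of_nonneg (by positivity)]
  push_cast
  have h1 : ((d : ℝ) + 2) ^ 2 ≤ 4 * d ^ 2 := by nlinarith
  have h2 : (d : ℝ) ^ 2 ≤ d ^ 2 * Real.log d := le_mul_of_one_le_right (by positivity) hlog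
  calc (C : ℝ) * (d + 2) ^ 2 ≤ C * (4 * (d ^ 2 * Real.log d)) := by gcongr; linarith
    _ = _ := by ring

theorem theorem3p3 :
    (∀ (d : ℕ) (Λ : (Fin (2 * d + 1) → ℝ) →ₗ[ℝ] Matrix (Fin (d + 1)) (Fin (d + 1)) ℝ),
      SOSBarrier.IsSOSOperator (SOSBarrier.monomials d) (SOSBarrier.monomials (2 * d)) Λ ↔
        ∀ x, Λ x = SOSBarrier.hankel d x) ∧
    ∃ (P : RealRAM.Program) (T : ℕ → ℕ),
      Asymptotics.IsBigO Filter.atTop (fun d : ℕ => (T d : ℝ))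
        (fun d : ℕ => (d : ℝ) ^ 2 * Real.log (d : ℝ)) ∧
      ∀ (d : ℕ) (Λ : (Fin (2 * d + 1) → ℝ) →ₗ[ℝ] Matrix (Fin (d + 1)) (Fin (d + 1)) ℝ),
        SOSBarrier.IsSOSOperator (SOSBarrier.monomials d) (SOSBarrier.monomials (2 * d)) Λ →
        ContDiffOn ℝ 2 (SOSBarrier.barrier Λ) (SOSBarrier.barrierDomain d) ∧
        ∀ x ∈ SOSBarrier.barrierDomain d,
          0 < (Λ x).det ∧
          ∃ (n : ℕ) (s : RealRAM.State),
            RealRAM.Runs P (RealRAM.initial d x) n s ∧ n ≤ T d ∧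
            (∀ u : Fin (2 * d + 1),
              s.arr 1 (u : ℕ) = SOSBarrier.grad (SOSBarrier.barrier Λ) x u) ∧
            ∀ u v : Fin (2 * d + 1),
              s.arr 2 ((u : ℕ) * (2 * d + 1) + (v : ℕ)) =
                SOSBarrier.hess (SOSBarrier.barrier Λ) x u v := by
  refine ⟨SOSBarrier.isSOSOperator_iff, RealRAM.barrierProgram, fun d => 400 * (d + 2) ^ 2,
    isBigO_sq_log 400, fun d Λ hΛ => ?_⟩
  rw [SOSBarrier.isSOSOperator_iff] at hΛ
  have hdet : ∀ x ∈ SOSBarrier.barrierDomain d, 0 < (Λ x).det := fun x hx => by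
    rw [hΛ]
    exact (SOSBarrier.posDef_hankel (SOSBarrier.isPositive_of_mem_barrierDomain hx)).det_pos
  refine ⟨SOSBarrier.contDiffOn_barrier Λ fun x hx => (hdet x hx).ne', fun x hx =>
    ⟨hdet x hx, ?_⟩⟩
  have hm := SOSBarrier.isPositive_of_mem_barrierDomain hx
  obtain ⟨n, s, hr, hn, h1, h2⟩ := RealRAM.barrierProgram_spec hm (RealRAM.isQuotient_kernel hm)
    (s := RealRAM.initial d x) (by simp [RealRAM.initial]) (by simp [RealRAM.initial])
    (by ext k; simp [RealRAM.initial, SOSBarrier.moments])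
    (fun a ha => by ext k; simp [RealRAM.initial, ha])
  refine ⟨n, s, hr, hn, fun u => ?_, fun u v => ?_⟩
  · rw [h1 u u.2, SOSBarrier.grad_barrier_eq_sum Λ (hdet x hx).ne', Finset.sum_range]
    congr 1
    refine Finset.sum_congr rfl fun v _ => ?_
    rw [SOSBarrier.hess_barrier_eq_coeff hΛ hm, SOSBarrier.moments_apply]
  · rw [h2 u u.2 v v.2, SOSBarrier.hess_barrier_eq_coeff hΛ hm]
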